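/- **Theorem (completeness of the categorical semantics of $\lambda_{\mathrm{eff}}$).** *Types.* Fix a set of operation symbols. Value types are $A,B ::= A\to C\mid\prod_{i=1}^nA_i$ ($n\ge 0$), computation types are $C ::= A\,!\,\Sigma$, and a signature $\Sigma$ is a finite partial function from operation symbols to pairs of value types; write $(\mathtt{op}:A_{\mathtt{op}}\rightarrowtriangle B_{\mathtt{op}})\in\Sigma$. Contexts are lists $\Gamma=x_1:A_1,\dots,x_n:A_n$. *Terms.* Terms carry their typing derivations and are taken up to $\alpha$-equivalence. Value terms $\Gamma\vdash V:A$ are variables, $\lambda x.M:A\to C$ (for $\Gamma,x:A\vdash M:C$), tuples $\langle V_1,\dots,V_n\rangle$ and projections $\pi_iV$. Computation terms $\Gamma\vdash M:C$ are $V\,W:C$ (for $V:A\to C$, $W:A$); $\mathtt{return}\,V:A!\Sigma$; $\mathtt{let}\,x=M\,\mathtt{in}\,N:B!\Sigma$ (for $M:A!\Sigma$, $\Gamma,x:A\vdash N:B!\Sigma$); $\mathtt{op}(V):B_{\mathtt{op}}!\Sigma$ (for $\mathtt{op}\in\Sigma$, $V:A_{\mathtt{op}}$); and $\mathtt{handle}\,M\,\mathtt{with}\,H\,\mathtt{to}\,x.N:C$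 (for $M:A!\Sigma$, $\Gamma\vdash H:\Sigma\Rightarrow C$, $\Gamma,x:A\vdash N:C$). A handler $\Gamma\vdash H:\Sigma\Rightarrow C$ consists of exactly one clause $\mathtt{op}(x,k)\mapsto M_{\mathtt{op}}$ for each $\mathtt{op}\in\Sigma$, where $\Gamma,x:A_{\mathtt{op}},k:B_{\mathtt{op}}\to C\vdash M_{\mathtt{op}}:C$. *Equational theory.* The judgements $\Gamma\vdash V=W:A$, $\Gamma\vdash M=N:C$, $\Gamma\vdash H=H':\Sigma\Rightarrow C$ form the least typed congruence (reflexive, symmetric, transitive, compatible with all term constructors) containing $$(\lambda x.M)V=M[V/x],\quad V=\lambda x.(V\,x),\quad \pi_i\langle V_1,\dots,V_n\rangle=V_i,\quad V=\langle\pi_1V,\dots,\pi_nV\rangle,$$ $$\mathtt{let}\,x=\mathtt{return}\,V\,\mathtt{in}\,M=M[V/x],\qquad \mathtt{let}\,x=M\,\mathtt{in}\,\mathtt{return}\,x=M,$$ $$\mathtt{let}\,y=(\mathtt{let}\,x=M\,\mathtt{in}\,N)\,\mathtt{in}\,L=\mathtt{let}\,x=M\,\mathtt{in}\,\mathtt{let}\,y=N\,\mathtt{in}\,L,$$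 $$\mathtt{handle}\,\mathtt{return}\,V\,\mathtt{with}\,H\,\mathtt{to}\,x.M=M[V/x],$$ $$\mathtt{handle}\,(\mathtt{let}\,x=L\,\mathtt{in}\,M)\,\mathtt{with}\,H\,\mathtt{to}\,y.N=\mathtt{handle}\,L\,\mathtt{with}\,H\,\mathtt{to}\,x.(\mathtt{handle}\,M\,\mathtt{with}\,H\,\mathtt{to}\,y.N),$$ $$\mathtt{handle}\,\mathtt{op}(V)\,\mathtt{with}\,H\,\mathtt{to}\,x.M=M_{\mathtt{op}}[V/x,\ \lambda x.M/k]\quad\text{for }(\mathtt{op}(x,k)\mapsto M_{\mathtt{op}})\in H.$$ *Models.* A semantic signature in a category $\mathcal C$ is a finite partial function $S$ from operation symbols to pairs of objects. A $\lambda_{\mathrm{eff}}$-model consists of - a category $\mathcal C$ with chosen finite products; - for each semantic signature $S$, a strong monad $T_S=(T_S,\eta,\mu,\mathrm{st})$ on $\mathcal C$ with chosen Kleisli exponentials $Y\Rightarrow_SZ$, that is, bijections $\Lambda:\mathcal C(X\times Y,T_SZ)\cong\mathcal C(X,Y\Rightarrow_SZ)$ natural in $X$; put $\mathrm{ev}=\Lambda^{-1}(\mathrm{id})$;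 - for each $S$ and $(\mathtt{op}:A\rightarrowtriangle B)\in S$, a morphism $[\![\mathtt{op}]\!]_S:A\to T_SB$; - for all $S,S'$ and each object $X$, a morphism $\mathbf{handle}_{S,S',X}:\mathcal H\times T_ST_{S'}X\to T_{S'}X$, where $\mathcal H=\mathcal H_{S,S',X}=\prod_{(\mathtt{op}:A\rightarrowtriangle B)\in S}\big((A\times(B\Rightarrow_{S'}X))\Rightarrow_{S'}X\big)$, such that $$\mathbf{handle}\circ(\mathrm{id}\times\eta)=\pi_2,\qquad \mathbf{handle}\circ(\mathrm{id}\times\mu)=\mathbf{handle}\circ(\mathrm{id}\times T_S\mathbf{handle})\circ\langle\pi_1,\mathrm{st}\rangle,$$ $$\mathbf{handle}\circ\big(\mathrm{id}\times(T_S\mathrm{ev}\circ\mathrm{st}\circ\mathrm{swap}\circ([\![\mathtt{op}]\!]_S\times\mathrm{id}))\big)=\mathrm{ev}\circ(\pi_{\mathtt{op}}\times\mathrm{id})\quad\text{for each }\mathtt{op}\in S.$$ *Interpretation.* In a model, $[\![\prod_iA_i]\!]=\prod_i[\![A_i]\!]$, $[\![A\to B!\Sigma]\!]=[\![A]\!]\Rightarrow_{[\![\Sigma]\!]}[\![B]\!]$,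 $[\![\Sigma]\!]$ is obtained by interpreting the types in $\Sigma$, $[\![\cdot]\!]=1$ and $[\![\Gamma,x:A]\!]=[\![\Gamma]\!]\times[\![A]\!]$. Terms are interpreted as morphisms $[\![V]\!]:[\![\Gamma]\!]\to[\![A]\!]$, $[\![M]\!]:[\![\Gamma]\!]\to T_{[\![\Sigma]\!]}[\![A]\!]$ for $M:A!\Sigma$, and $[\![H]\!]:[\![\Gamma]\!]\to\mathcal H_{[\![\Sigma]\!],[\![\Sigma']\!],[\![A]\!]}$ for $H:\Sigma\Rightarrow A!\Sigma'$. Variables, tuples and projections are interpreted by the product structure, and $$[\![\lambda x.M]\!]=\Lambda[\![M]\!],\quad [\![V\,W]\!]=\mathrm{ev}\circ\langle[\![V]\!],[\![W]\!]\rangle,\quad [\![\mathtt{return}\,V]\!]=\eta\circ[\![V]\!],\quad [\![\mathtt{op}(V)]\!]=[\![\mathtt{op}]\!]_{[\![\Sigma]\!]}\circ[\![V]\!],$$ $$[\![\mathtt{let}\,x=M\,\mathtt{in}\,N]\!]=\mu\circ T[\![N]\!]\circ\mathrm{st}\circ\langle\mathrm{id},[\![M]\!]\rangle,$$ $$[\![H]\!]=\langle\Lambda([\![M_{\mathtt{op}}]\!]\circ\alpha^{-1})\rangle_{\mathtt{op}\in\Sigma},\qquad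 [\![\mathtt{handle}\,M\,\mathtt{with}\,H\,\mathtt{to}\,x.N]\!]=\mathbf{handle}\circ\langle[\![H]\!],\,T[\![N]\!]\circ\mathrm{st}\circ\langle\mathrm{id},[\![M]\!]\rangle\rangle,$$ where $T=T_{[\![\Sigma]\!]}$ with $\Sigma$ the signature of $M$, and $\alpha:(X\times Y)\times Z\to X\times(Y\times Z)$ is the associator. *Claim.* Let $\Gamma$ be a context. 1. If $\Gamma\vdash V:A$ and $\Gamma\vdash W:A$ are value terms with $[\![V]\!]=[\![W]\!]$ in every $\lambda_{\mathrm{eff}}$-model, then $\Gamma\vdash V=W:A$ is derivable. 2. If $\Gamma\vdash M:C$ and $\Gamma\vdash N:C$ are computation terms with $[\![M]\!]=[\![N]\!]$ in every $\lambda_{\mathrm{eff}}$-model, then $\Gamma\vdash M=N:C$ is derivable. 3. If $\Gamma\vdash H:\Sigma\Rightarrow C$ and $\Gamma\vdash H':\Sigma\Rightarrow C$ are handlers with $[\![H]\!]=[\![H']\!]$ in every $\lambda_{\mathrm{eff}}$-model, then $\Gamma\vdash H=H':\Sigma\Rightarrow C$ is derivable. -/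

import Mathlib

-- so that `X ⟶ Y` elaborates to the morphisms of the category, not of its reflexive quiver
attribute [-instance] CategoryTheory.catToReflQuiver

namespace EffCalc

open CategoryTheory CategoryTheory.Limits MonoidalCategory CartesianMonoidalCategory

universe u v

/-! ### Signatures and types -/

/-- A signature over a collection `X`: a partial function with finite domain from operation
symbols to pairs of elements of `X`. With `X` the value types these are the syntactic signatures,
with `X` the objects of a category they are the semantic signatures. -/
structure Signature (Op : Type u) (X : Type v) where
  /-- the operation symbols of the signature -/
  dom : Finset Op
  /-- the argument type of an operation -/
  arg : {o // o ∈ dom} → X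
  /-- the return type of an operation -/
  res : {o // o ∈ dom} → X

/-- Value types: finite products `∏ i, A i`, and function types `A → B ! Σ`, where the signature
`Σ` is spelled out as in `Signature`. -/
inductive Ty (Op : Type u) : Type u
  | prod {n : ℕ} (A : Fin n → Ty Op) : Ty Op
  | arr (A B : Ty Op) (dom : Finset Op) (arg res : {o // o ∈ dom} → Ty Op) : Ty Op

/-- Syntactic signatures. -/
abbrev Sig (Op : Type u) : Type u := Signature Op (Ty Op)

/-- Computation types `A ! Σ`. -/
structure CTy (Op : Type u) : Type u where
  val : Ty Op
  sig : Sig Op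

/-- The function type `A → C`. -/
abbrev Ty.fn {Op : Type u} (A : Ty Op) (C : CTy Op) : Ty Op :=
  .arr A C.val C.sig.dom C.sig.arg C.sig.res

/-- Contexts; the most recently bound variable comes first. -/
abbrev Ctx (Op : Type u) : Type u := List (Ty Op)

/-! ### Terms

Terms are represented up to `α`-equivalence, by typing derivations with de Bruijn indices. -/

/-- `Var Γ A`: the variables of type `A` in `Γ`. -/
inductive Var {Op : Type u} : Ctx Op → Ty Op → Type u
  | zero {Γ : Ctx Op} {A : Ty Op} : Var (A :: Γ) A
  | succ {Γ : Ctx Op} {A B : Ty Op} : Var Γ A → Var (B :: Γ) A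

mutual

/-- Value terms `Γ ⊢ V : A`. -/
inductive Val {Op : Type u} : Ctx Op → Ty Op → Type u
  | var {Γ : Ctx Op} {A : Ty Op} : Var Γ A → Val Γ A
  | lam {Γ : Ctx Op} {A : Ty Op} {C : CTy Op} : Comp (A :: Γ) C → Val Γ (Ty.fn A C)
  | tuple {Γ : Ctx Op} {n : ℕ} {A : Fin n → Ty Op} : (∀ i, Val Γ (A i)) → Val Γ (Ty.prod A)
  | proj {Γ : Ctx Op} {n : ℕ} {A : Fin n → Ty Op} (i : Fin n) : Val Γ (Ty.prod A) → Val Γ (A i)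

/-- Computation terms `Γ ⊢ M : C`; `handle M H N` is `handle M with H to x. N`. -/
inductive Comp {Op : Type u} : Ctx Op → CTy Op → Type u
  | app {Γ : Ctx Op} {A : Ty Op} {C : CTy Op} : Val Γ (Ty.fn A C) → Val Γ A → Comp Γ C
  | ret {Γ : Ctx Op} {A : Ty Op} {S : Sig Op} : Val Γ A → Comp Γ ⟨A, S⟩
  | letIn {Γ : Ctx Op} {A B : Ty Op} {S : Sig Op} :
      Comp Γ ⟨A, S⟩ → Comp (A :: Γ) ⟨B, S⟩ → Comp Γ ⟨B, S⟩
  | op {Γ : Ctx Op} {S : Sig Op} (o : {o // o ∈ S.dom}) : Val Γ (S.arg o) → Comp Γ ⟨S.res o, S⟩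
  | handle {Γ : Ctx Op} {A : Ty Op} {S : Sig Op} {C : CTy Op} :
      Comp Γ ⟨A, S⟩ → Handler Γ S C → Comp (A :: Γ) C → Comp Γ C

/-- Handlers `Γ ⊢ H : Σ ⇒ C`: one clause `op(x, k) ↦ M_op` for each operation of `Σ`, where
`Γ, x : A_op, k : B_op → C ⊢ M_op : C`. -/
inductive Handler {Op : Type u} : Ctx Op → Sig Op → CTy Op → Type u
  | mk {Γ : Ctx Op} {S : Sig Op} {C : CTy Op} :
      (∀ o : {o // o ∈ S.dom}, Comp (Ty.fn (S.res o) C :: S.arg o :: Γ) C) → Handler Γ S C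

end

/-! ### Renaming and substitution -/

/-- Renamings of the variables of `Γ` by variables of `Δ`. -/
abbrev Ren {Op : Type u} (Γ Δ : Ctx Op) : Type u := ∀ ⦃A : Ty Op⦄, Var Γ A → Var Δ A

/-- Extension of a renaming under a binder. -/
def Ren.up {Op : Type u} {Γ Δ : Ctx Op} {B : Ty Op} (ρ : Ren Γ Δ) : Ren (B :: Γ) (B :: Δ)
  | _, .zero => .zero
  | _, .succ x => .succ (ρ x)

/-- The weakening renaming. -/
def Ren.wk {Op : Type u} {Γ : Ctx Op} {B : Ty Op} : Ren Γ (B :: Γ) := fun _ x => .succ x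

mutual

/-- Renaming in value terms. -/
def Val.rename {Op : Type u} : {Γ Δ : Ctx Op} → {A : Ty Op} → Val Γ A → Ren Γ Δ → Val Δ A
  | _, _, _, .var x, ρ => .var (ρ x)
  | _, _, _, .lam M, ρ => .lam (M.rename ρ.up)
  | _, _, _, .tuple V, ρ => .tuple fun i => (V i).rename ρ
  | _, _, _, .proj (A := _) i V, ρ => .proj i (V.rename ρ)

/-- Renaming in computation terms. -/
def Comp.rename {Op : Type u} : {Γ Δ : Ctx Op} → {C : CTy Op} → Comp Γ C → Ren Γ Δ → Comp Δ C
  | _, _, _, .app V W, ρ => .app (V.rename ρ) (W.rename ρ)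
  | _, _, _, .ret V, ρ => .ret (V.rename ρ)
  | _, _, _, .letIn M N, ρ => .letIn (M.rename ρ) (N.rename ρ.up)
  | _, _, _, .op o V, ρ => .op o (V.rename ρ)
  | _, _, _, .handle M H N, ρ => .handle (M.rename ρ) (H.rename ρ) (N.rename ρ.up)

/-- Renaming in handlers. -/
def Handler.rename {Op : Type u} :
    {Γ Δ : Ctx Op} → {S : Sig Op} → {C : CTy Op} → Handler Γ S C → Ren Γ Δ → Handler Δ S C
  | _, _, _, _, .mk M, ρ => .mk fun o => (M o).rename ρ.up.up

end

/-- Substitutions of value terms over `Δ` for the variables of `Γ`. -/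
abbrev Sub {Op : Type u} (Γ Δ : Ctx Op) : Type u := ∀ ⦃A : Ty Op⦄, Var Γ A → Val Δ A

/-- Extension of a substitution under a binder. -/
def Sub.up {Op : Type u} {Γ Δ : Ctx Op} {B : Ty Op} (σ : Sub Γ Δ) : Sub (B :: Γ) (B :: Δ)
  | _, .zero => .var .zero
  | _, .succ x => (σ x).rename Ren.wk

/-- The identity substitution. -/
def Sub.id {Op : Type u} {Γ : Ctx Op} : Sub Γ Γ := fun _ x => .var x

/-- The substitution that maps the last variable to `V` and is `σ` on the others. -/
def Sub.cons {Op : Type u} {Γ Δ : Ctx Op} {B : Ty Op} (σ : Sub Γ Δ) (V : Val Δ B) :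
    Sub (B :: Γ) Δ
  | _, .zero => V
  | _, .succ x => σ x

mutual

/-- Substitution in value terms. -/
def Val.subst {Op : Type u} : {Γ Δ : Ctx Op} → {A : Ty Op} → Val Γ A → Sub Γ Δ → Val Δ A
  | _, _, _, .var x, σ => σ x
  | _, _, _, .lam M, σ => .lam (M.subst σ.up)
  | _, _, _, .tuple V, σ => .tuple fun i => (V i).subst σ
  | _, _, _, .proj (A := _) i V, σ => .proj i (V.subst σ)

/-- Substitution in computation terms. -/
def Comp.subst {Op : Type u} : {Γ Δ : Ctx Op} → {C : CTy Op} → Comp Γ C → Sub Γ Δ → Comp Δ C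
  | _, _, _, .app V W, σ => .app (V.subst σ) (W.subst σ)
  | _, _, _, .ret V, σ => .ret (V.subst σ)
  | _, _, _, .letIn M N, σ => .letIn (M.subst σ) (N.subst σ.up)
  | _, _, _, .op o V, σ => .op o (V.subst σ)
  | _, _, _, .handle M H N, σ => .handle (M.subst σ) (H.subst σ) (N.subst σ.up)

/-- Substitution in handlers. -/
def Handler.subst {Op : Type u} :
    {Γ Δ : Ctx Op} → {S : Sig Op} → {C : CTy Op} → Handler Γ S C → Sub Γ Δ → Handler Δ S C
  | _, _, _, _, .mk M, σ => .mk fun o => (M o).subst σ.up.up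

end

/-- `M[V/x]` for the last variable `x` of the context. -/
abbrev Comp.inst {Op : Type u} {Γ : Ctx Op} {A : Ty Op} {C : CTy Op}
    (M : Comp (A :: Γ) C) (V : Val Γ A) : Comp Γ C :=
  M.subst (Sub.id.cons V)

/-- `M[V/x, W/k]` for the last two variables `x, k` of the context. -/
abbrev Comp.inst₂ {Op : Type u} {Γ : Ctx Op} {A B : Ty Op} {C : CTy Op}
    (M : Comp (B :: A :: Γ) C) (V : Val Γ A) (W : Val Γ B) : Comp Γ C :=
  M.subst ((Sub.id.cons V).cons W)

/-! ### Equational theory -/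

mutual

/-- Derivability of `Γ ⊢ V = W : A`. -/
inductive ValEq {Op : Type u} : {Γ : Ctx Op} → {A : Ty Op} → Val Γ A → Val Γ A → Prop
  | refl {Γ : Ctx Op} {A : Ty Op} (V : Val Γ A) : ValEq V V
  | symm {Γ : Ctx Op} {A : Ty Op} {V W : Val Γ A} : ValEq V W → ValEq W V
  | trans {Γ : Ctx Op} {A : Ty Op} {U V W : Val Γ A} : ValEq U V → ValEq V W → ValEq U W
  | lam_congr {Γ : Ctx Op} {A : Ty Op} {C : CTy Op} {M N : Comp (A :: Γ) C} :
      CompEq M N → ValEq (.lam M) (.lam N)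
  | tuple_congr {Γ : Ctx Op} {n : ℕ} {A : Fin n → Ty Op} {V W : ∀ i, Val Γ (A i)} :
      (∀ i, ValEq (V i) (W i)) → ValEq (.tuple V) (.tuple W)
  | proj_congr {Γ : Ctx Op} {n : ℕ} {A : Fin n → Ty Op} (i : Fin n) {V W : Val Γ (Ty.prod A)} :
      ValEq V W → ValEq (.proj i V) (.proj i W)
  | abs_eta {Γ : Ctx Op} {A : Ty Op} {C : CTy Op} (V : Val Γ (Ty.fn A C)) :
      ValEq V (.lam (.app (V.rename Ren.wk) (.var .zero)))
  | prod_beta {Γ : Ctx Op} {n : ℕ} {A : Fin n → Ty Op} (i : Fin n) (V : ∀ i, Val Γ (A i)) :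
      ValEq (.proj i (.tuple V)) (V i)
  | prod_eta {Γ : Ctx Op} {n : ℕ} {A : Fin n → Ty Op} (V : Val Γ (Ty.prod A)) :
      ValEq V (.tuple fun i => .proj i V)

/-- Derivability of `Γ ⊢ M = N : C`. -/
inductive CompEq {Op : Type u} : {Γ : Ctx Op} → {C : CTy Op} → Comp Γ C → Comp Γ C → Prop
  | refl {Γ : Ctx Op} {C : CTy Op} (M : Comp Γ C) : CompEq M M
  | symm {Γ : Ctx Op} {C : CTy Op} {M N : Comp Γ C} : CompEq M N → CompEq N M
  | trans {Γ : Ctx Op} {C : CTy Op} {L M N : Comp Γ C} : CompEq L M → CompEq M N → CompEq L N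
  | app_congr {Γ : Ctx Op} {A : Ty Op} {C : CTy Op} {V V' : Val Γ (Ty.fn A C)} {W W' : Val Γ A} :
      ValEq V V' → ValEq W W' → CompEq (.app V W) (.app V' W')
  | ret_congr {Γ : Ctx Op} {A : Ty Op} {S : Sig Op} {V W : Val Γ A} :
      ValEq V W → CompEq (.ret (S := S) V) (.ret W)
  | let_congr {Γ : Ctx Op} {A B : Ty Op} {S : Sig Op} {M M' : Comp Γ ⟨A, S⟩}
      {N N' : Comp (A :: Γ) ⟨B, S⟩} :
      CompEq M M' → CompEq N N' → CompEq (.letIn M N) (.letIn M' N')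
  | op_congr {Γ : Ctx Op} {S : Sig Op} (o : {o // o ∈ S.dom}) {V W : Val Γ (S.arg o)} :
      ValEq V W → CompEq (.op o V) (.op o W)
  | handle_congr {Γ : Ctx Op} {A : Ty Op} {S : Sig Op} {C : CTy Op} {M M' : Comp Γ ⟨A, S⟩}
      {H H' : Handler Γ S C} {N N' : Comp (A :: Γ) C} :
      CompEq M M' → HandlerEq H H' → CompEq N N' → CompEq (.handle M H N) (.handle M' H' N')
  | abs_beta {Γ : Ctx Op} {A : Ty Op} {C : CTy Op} (M : Comp (A :: Γ) C) (V : Val Γ A) :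
      CompEq (.app (.lam M) V) (M.inst V)
  | ret_let {Γ : Ctx Op} {A B : Ty Op} {S : Sig Op} (V : Val Γ A) (M : Comp (A :: Γ) ⟨B, S⟩) :
      CompEq (.letIn (.ret V) M) (M.inst V)
  | let_let {Γ : Ctx Op} {A₁ A₂ A₃ : Ty Op} {S : Sig Op} (M : Comp Γ ⟨A₁, S⟩)
      (N : Comp (A₁ :: Γ) ⟨A₂, S⟩) (L : Comp (A₂ :: Γ) ⟨A₃, S⟩) :
      CompEq (.letIn (.letIn M N) L) (.letIn M (.letIn N (L.rename (Ren.up Ren.wk))))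
  | let_ret {Γ : Ctx Op} {A : Ty Op} {S : Sig Op} (M : Comp Γ ⟨A, S⟩) :
      CompEq (.letIn M (.ret (.var .zero))) M
  | handle_ret {Γ : Ctx Op} {A : Ty Op} {S : Sig Op} {C : CTy Op} (V : Val Γ A)
      (H : Handler Γ S C) (M : Comp (A :: Γ) C) :
      CompEq (.handle (.ret V) H M) (M.inst V)
  | handle_let {Γ : Ctx Op} {A B : Ty Op} {S : Sig Op} {C : CTy Op} (H : Handler Γ S C)
      (L : Comp Γ ⟨A, S⟩) (M : Comp (A :: Γ) ⟨B, S⟩) (N : Comp (B :: Γ) C) :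
      CompEq (.handle (.letIn L M) H N)
        (.handle L H (.handle M (H.rename Ren.wk) (N.rename (Ren.up Ren.wk))))
  | handle_op {Γ : Ctx Op} {S : Sig Op} {C : CTy Op} (o : {o // o ∈ S.dom})
      (H : ∀ o : {o // o ∈ S.dom}, Comp (Ty.fn (S.res o) C :: S.arg o :: Γ) C)
      (M : Comp (S.res o :: Γ) C) (V : Val Γ (S.arg o)) :
      CompEq (.handle (.op o V) (.mk H) M) ((H o).inst₂ V (.lam M))

/-- Derivability of `Γ ⊢ H = H' : Σ ⇒ C`. -/
inductive HandlerEq {Op : Type u} :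
    {Γ : Ctx Op} → {S : Sig Op} → {C : CTy Op} → Handler Γ S C → Handler Γ S C → Prop
  | refl {Γ : Ctx Op} {S : Sig Op} {C : CTy Op} (H : Handler Γ S C) : HandlerEq H H
  | symm {Γ : Ctx Op} {S : Sig Op} {C : CTy Op} {H H' : Handler Γ S C} :
      HandlerEq H H' → HandlerEq H' H
  | trans {Γ : Ctx Op} {S : Sig Op} {C : CTy Op} {H H' H'' : Handler Γ S C} :
      HandlerEq H H' → HandlerEq H' H'' → HandlerEq H H''
  | congr {Γ : Ctx Op} {S : Sig Op} {C : CTy Op}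
      {M N : ∀ o : {o // o ∈ S.dom}, Comp (Ty.fn (S.res o) C :: S.arg o :: Γ) C} :
      (∀ o, CompEq (M o) (N o)) → HandlerEq (.mk M) (.mk N)

end

/-! ### Cartesian categories -/

/-- A cartesian category: a category with (chosen) finite products `∏_{i=1}^n X_i`. -/
class CartesianCat (C : Type u) [Category.{v} C] where
  /-- the product object -/
  pi {n : ℕ} (X : Fin n → C) : C
  /-- the projections -/
  π {n : ℕ} (X : Fin n → C) (i : Fin n) : pi X ⟶ X i
  /-- tupling -/
  tuple {n : ℕ} {X : Fin n → C} {Z : C} (f : ∀ i, Z ⟶ X i) : Z ⟶ pi X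
  tuple_π {n : ℕ} {X : Fin n → C} {Z : C} (f : ∀ i, Z ⟶ X i) (i : Fin n) : tuple f ≫ π X i = f i
  hom_ext {n : ℕ} {X : Fin n → C} {Z : C} (f g : Z ⟶ pi X) :
    (∀ i, f ≫ π X i = g ≫ π X i) → f = g

namespace CartesianCat

variable {C : Type u} [Category.{v} C] [CartesianCat C]

/-- The terminal object is the empty product. -/
def terminalCone : LimitCone (Functor.empty.{0} C) where
  cone := asEmptyCone (pi (Fin.elim0 : Fin 0 → C))
  isLimit := IsTerminal.ofUniqueHom (fun _ => tuple fun i => i.elim0)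
    fun _ _ => hom_ext _ _ fun i => i.elim0

/-- Pairing into `pi ![X, Y]`. -/
def pair {X Y Z : C} (f : Z ⟶ X) (g : Z ⟶ Y) : Z ⟶ pi ![X, Y] :=
  tuple (Fin.cons (α := fun i => Z ⟶ ![X, Y] i) f (Fin.cons (α := fun i : Fin 1 => Z ⟶ ![Y] i) g
    fun i => i.elim0))

theorem pair_π_zero {X Y Z : C} (f : Z ⟶ X) (g : Z ⟶ Y) : pair f g ≫ π ![X, Y] 0 = f :=
  tuple_π (X := ![X, Y]) _ 0

theorem pair_π_one {X Y Z : C} (f : Z ⟶ X) (g : Z ⟶ Y) : pair f g ≫ π ![X, Y] 1 = g :=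
  tuple_π (X := ![X, Y]) _ 1

/-- Binary products are the products of families of length two. -/
def pairCone (X Y : C) : LimitCone (Limits.pair X Y) where
  cone := BinaryFan.mk (P := pi ![X, Y]) (π ![X, Y] 0) (π ![X, Y] 1)
  isLimit := BinaryFan.IsLimit.mk _ (fun f g => pair f g) pair_π_zero pair_π_one
    (fun f g m hf hg => hom_ext (X := ![X, Y]) _ _ fun i => by
      refine Fin.cases ?_ (fun j => ?_) i
      · exact hf.trans (pair_π_zero f g).symm
      · obtain rfl : j = 0 := Subsingleton.elim _ _
        exact hg.trans (pair_π_one f g).symm)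

/-- The terminal object `𝟙_ C` and the binary products `X ⊗ Y`, with Mathlib's notation. -/
instance : CartesianMonoidalCategory C := .ofChosenFiniteProducts terminalCone pairCone

/-- The product of a family indexed by a finite set, along an enumeration of the set. -/
noncomputable abbrev piFinite {J : Type*} [Fintype J] (X : J → C) : C :=
  pi fun i => X ((Fintype.equivFin J).symm i)

/-- The projections of `piFinite`. -/
noncomputable def πFinite {J : Type*} [Fintype J] (X : J → C) (j : J) : piFinite X ⟶ X j :=
  π (fun i => X ((Fintype.equivFin J).symm i)) (Fintype.equivFin J j) ≫ eqToHom (by simp)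

/-- Tupling into `piFinite`. -/
noncomputable def tupleFinite {J : Type*} [Fintype J] {X : J → C} {Z : C} (f : ∀ j, Z ⟶ X j) :
    Z ⟶ piFinite X :=
  tuple fun i => f ((Fintype.equivFin J).symm i)

theorem tupleFinite_πFinite {J : Type*} [Fintype J] {X : J → C} {Z : C} (f : ∀ j, Z ⟶ X j)
    (j : J) : tupleFinite f ≫ πFinite X j = f j := by
  have aux : ∀ (j' : J) (h : j' = j), f j' ≫ eqToHom (by rw [h]) = f j := by
    rintro _ rfl
    simp
  unfold tupleFinite πFinite
  rw [← Category.assoc, tuple_π]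
  exact aux _ (by simp)

theorem piFinite_hom_ext {J : Type*} [Fintype J] {X : J → C} {Z : C} (f g : Z ⟶ piFinite X)
    (h : ∀ j, f ≫ πFinite X j = g ≫ πFinite X j) : f = g := by
  apply CartesianCat.hom_ext
  intro i
  obtain ⟨j, rfl⟩ := (Fintype.equivFin J).surjective i
  have := h j
  unfold πFinite at this
  rw [← Category.assoc, ← Category.assoc] at this
  exact (cancel_mono _).1 this

end CartesianCat

open CartesianCat

/-! ### Strong monads and Kleisli exponentials -/

/-- A strong monad `(T, η, μ, st)` on a cartesian category. -/
structure StrongMonad (C : Type u) [Category.{v} C] [CartesianMonoidalCategory C] where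
  /-- the underlying monad -/
  T : Monad C
  /-- the strength -/
  st (X Y : C) : X ⊗ T.obj Y ⟶ T.obj (X ⊗ Y)
  st_natural {X X' Y Y' : C} (f : X ⟶ X') (g : Y ⟶ Y') :
    (f ⊗ₘ T.map g) ≫ st X' Y' = st X Y ≫ T.map (f ⊗ₘ g)
  st_leftUnitor (X : C) : st (𝟙_ C) X ≫ T.map (λ_ X).hom = (λ_ (T.obj X)).hom
  st_associator (X Y Z : C) :
    st (X ⊗ Y) Z ≫ T.map (α_ X Y Z).hom =
      (α_ X Y (T.obj Z)).hom ≫ (X ◁ st Y Z) ≫ st X (Y ⊗ Z)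
  st_unit (X Y : C) : (X ◁ T.η.app Y) ≫ st X Y = T.η.app (X ⊗ Y)
  st_mult (X Y : C) :
    (X ◁ T.μ.app Y) ≫ st X Y = st X (T.obj Y) ≫ T.map (st X Y) ≫ T.μ.app (X ⊗ Y)

/-- A Kleisli exponential `Y ⇒_T Z`: an object with bijections `C(X × Y, T Z) ≅ C(X, Y ⇒_T Z)`
natural in `X`. -/
structure KleisliExp {C : Type u} [Category.{v} C] [CartesianMonoidalCategory C]
    (T : Monad C) (Y Z : C) where
  /-- the exponential object -/
  obj : C
  /-- currying -/
  curry {X : C} : (X ⊗ Y ⟶ T.obj Z) ≃ (X ⟶ obj)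
  curry_natural {X X' : C} (f : X ⟶ X') (g : X' ⊗ Y ⟶ T.obj Z) :
    curry ((f ▷ Y) ≫ g) = f ≫ curry g

/-- The evaluation morphism `(Y ⇒_T Z) × Y ⟶ T Z`. -/
def KleisliExp.eval {C : Type u} [Category.{v} C] [CartesianMonoidalCategory C]
    {T : Monad C} {Y Z : C} (E : KleisliExp T Y Z) : E.obj ⊗ Y ⟶ T.obj Z :=
  E.curry.symm (𝟙 E.obj)

/-! ### Models -/

section Bundle

variable {Op : Type u} {C : Type u} [Category.{u} C] [CartesianCat C]

/-- The factor `(A_op × (B_op ⇒_T X)) ⇒_T X` of the object of handlers. -/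
abbrev clauseObj {T : StrongMonad C} (E : ∀ Y Z : C, KleisliExp T.T Y Z)
    (S : Signature Op C) (X : C) (o : {o // o ∈ S.dom}) : C :=
  (E (S.arg o ⊗ (E (S.res o) X).obj) X).obj

/-- The object of handlers: the product of `clauseObj` over the operations of `S`. -/
noncomputable abbrev HBundle {T : StrongMonad C} (E : ∀ Y Z : C, KleisliExp T.T Y Z)
    (S : Signature Op C) (X : C) : C :=
  piFinite (clauseObj E S X)

/-- The morphism `A × (B ⇒_{T'} X) ⟶ T (T' X)` induced by `f : A ⟶ T B`. -/
def mixedOp {T T' : StrongMonad C} (E' : ∀ Y Z : C, KleisliExp T'.T Y Z) {A B : C}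
    (f : A ⟶ T.T.obj B) (X : C) : A ⊗ (E' B X).obj ⟶ T.T.obj (T'.T.obj X) :=
  (f ▷ (E' B X).obj) ≫ lift (snd _ _) (fst _ _) ≫ T.st _ _ ≫ T.T.map (E' B X).eval

end Bundle

/-- Models of the calculus with operation symbols `Op`. Finite products and Kleisli exponentials
are chosen, since the interpretation of types refers to them. The category is small relative to
the universe of `Op`; quantifying over these models only makes a completeness claim stronger. -/
structure Model (Op : Type u) where
  /-- the objects -/
  C : Type u
  [cat : Category.{u} C]
  [cart : CartesianCat C]
  /-- the strong monads, indexed by semantic signatures -/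
  T : Signature Op C → StrongMonad C
  /-- the Kleisli exponentials -/
  exp (S : Signature Op C) (Y Z : C) : KleisliExp (T S).T Y Z
  /-- the interpretation of operations -/
  op (S : Signature Op C) (o : {o // o ∈ S.dom}) : S.arg o ⟶ (T S).T.obj (S.res o)
  /-- the handling morphisms -/
  handle (S S' : Signature Op C) (X : C) :
    HBundle (exp S') S X ⊗ (T S).T.obj ((T S').T.obj X) ⟶ (T S').T.obj X
  handle_unit (S S' : Signature Op C) (X : C) :
    (HBundle (exp S') S X ◁ (T S).T.η.app ((T S').T.obj X)) ≫ handle S S' X = snd _ _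
  handle_mult (S S' : Signature Op C) (X : C) :
    (HBundle (exp S') S X ◁ (T S).T.μ.app ((T S').T.obj X)) ≫ handle S S' X =
      lift (fst _ _) ((T S).st _ _) ≫
        (HBundle (exp S') S X ◁ (T S).T.map (handle S S' X)) ≫ handle S S' X
  handle_op (S S' : Signature Op C) (X : C) (o : {o // o ∈ S.dom}) :
    (HBundle (exp S') S X ◁ mixedOp (exp S') (op S o) X) ≫ handle S S' X =
      (πFinite (clauseObj (exp S') S X) o ▷ (S.arg o ⊗ (exp S' (S.res o) X).obj)) ≫
        (exp S' _ X).eval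

attribute [instance] Model.cat Model.cart

/-! ### Interpretation -/

namespace Model

variable {Op : Type u} (𝓜 : Model Op)

/-- Interpretation of value types. -/
@[reducible] def ty : Ty Op → 𝓜.C
  | .prod A => pi fun i => ty (A i)
  | .arr A B dom arg res =>
      (𝓜.exp ⟨dom, fun o => ty (arg o), fun o => ty (res o)⟩ (ty A) (ty B)).obj

/-- Interpretation of signatures. -/
abbrev sig (S : Sig Op) : Signature Op 𝓜.C :=
  ⟨S.dom, fun o => 𝓜.ty (S.arg o), fun o => 𝓜.ty (S.res o)⟩

/-- The strong monad `T_⟦Σ⟧`. -/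
abbrev TS (S : Sig Op) : StrongMonad 𝓜.C := 𝓜.T (𝓜.sig S)

/-- The object `T_⟦Σ⟧ ⟦A⟧` for a computation type `A ! Σ`. -/
abbrev cty (C : CTy Op) : 𝓜.C := (𝓜.TS C.sig).T.obj (𝓜.ty C.val)

/-- The object of handlers of type `Σ ⇒ C`. -/
noncomputable abbrev hty (S : Sig Op) (C : CTy Op) : 𝓜.C :=
  HBundle (𝓜.exp (𝓜.sig C.sig)) (𝓜.sig S) (𝓜.ty C.val)

/-- Interpretation of contexts. -/
@[reducible] def ctx : Ctx Op → 𝓜.C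
  | [] => 𝟙_ 𝓜.C
  | A :: Γ => ctx Γ ⊗ 𝓜.ty A

/-- Interpretation of variables. -/
def var : {Γ : Ctx Op} → {A : Ty Op} → Var Γ A → (𝓜.ctx Γ ⟶ 𝓜.ty A)
  | _, _, .zero => snd _ _
  | _, _, .succ x => fst _ _ ≫ var x

/-- The Kleisli exponential that interprets `A → C`. -/
abbrev fnExp (A : Ty Op) (C : CTy Op) :
    KleisliExp (𝓜.TS C.sig).T (𝓜.ty A) (𝓜.ty C.val) :=
  𝓜.exp (𝓜.sig C.sig) (𝓜.ty A) (𝓜.ty C.val)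

mutual

/-- Interpretation of value terms. -/
noncomputable def val : {Γ : Ctx Op} → {A : Ty Op} → Val Γ A → (𝓜.ctx Γ ⟶ 𝓜.ty A)
  | _, _, .var x => 𝓜.var x
  | _, _, .lam (A := A) (C := C) M => (𝓜.fnExp A C).curry (comp M)
  | _, _, .tuple V => tuple fun i => val (V i)
  | _, _, .proj (A := A) i V => val V ≫ π (fun i => 𝓜.ty (A i)) i

/-- Interpretation of computation terms. -/
noncomputable def comp : {Γ : Ctx Op} → {C : CTy Op} → Comp Γ C → (𝓜.ctx Γ ⟶ 𝓜.cty C)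
  | _, _, .app (A := A) (C := C) V W => lift (val V) (val W) ≫ (𝓜.fnExp A C).eval
  | _, _, .ret (S := S) V => val V ≫ (𝓜.TS S).T.η.app _
  | Γ, _, .letIn (A := A) (S := S) M N =>
      lift (𝟙 _) (comp M) ≫ (𝓜.TS S).st (𝓜.ctx Γ) (𝓜.ty A) ≫ (𝓜.TS S).T.map (comp N) ≫
        (𝓜.TS S).T.μ.app _
  | _, _, .op (S := S) o V => val V ≫ 𝓜.op (𝓜.sig S) o
  | Γ, _, .handle (A := A) (S := S) (C := C) M H N =>
      lift (handler H)
          (lift (𝟙 _) (comp M) ≫ (𝓜.TS S).st (𝓜.ctx Γ) (𝓜.ty A) ≫ (𝓜.TS S).T.map (comp N)) ≫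
        𝓜.handle (𝓜.sig S) (𝓜.sig C.sig) (𝓜.ty C.val)

/-- Interpretation of handlers. -/
noncomputable def handler :
    {Γ : Ctx Op} → {S : Sig Op} → {C : CTy Op} → Handler Γ S C → (𝓜.ctx Γ ⟶ 𝓜.hty S C)
  | Γ, _, _, .mk (S := S) (C := C) M =>
      tupleFinite fun o =>
        (𝓜.exp (𝓜.sig C.sig) (𝓜.ty (S.arg o) ⊗ (𝓜.fnExp (S.res o) C).obj) (𝓜.ty C.val)).curry
          ((α_ (𝓜.ctx Γ) (𝓜.ty (S.arg o)) (𝓜.fnExp (S.res o) C).obj).inv ≫ comp (M o))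

end

end Model

end EffCalc

/-!
Completeness is witnessed by a single model, the term model. Its objects are the value types, its
morphisms `A ⟶ B` are the terms of type `B` in one variable of type `A`, modulo derivable equality,
and `T_S A` is the type of thunks `1 → A ! S`, so that each law of a model is an instance of the
equational theory. By induction on a term, its interpretation there, evaluated at the tuple of the
variables of its context, is the class of the term itself. Hence two terms with the same
interpretation are derivably equal. In the term model a type is interpreted by itself, but this
equality is proved by induction and does not hold by definition: the comparison of a term with its
interpretation is up to transport along it.
-/

namespace EffCalc

open CategoryTheory CategoryTheory.Limits MonoidalCategory CartesianMonoidalCategory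

open CartesianCat

universe u

variable {Op : Type u}

/-! ### Substitution -/

section Substitution

variable {Γ Δ Θ : Ctx Op} {A B : Ty Op} {C : CTy Op} {S : Sig Op}

/-- A renaming, regarded as a substitution. -/
def Ren.toSub (ρ : Ren Γ Δ) : Sub Γ Δ := fun _ x => .var (ρ x)

/-- Composition of substitutions, in diagrammatic order. -/
def Sub.comp (σ : Sub Γ Δ) (τ : Sub Δ Θ) : Sub Γ Θ := fun _ x => (σ x).subst τ

theorem Ren.toSub_up (ρ : Ren Γ Δ) : (ρ.up (B := B)).toSub = ρ.toSub.up := by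
  funext A x
  cases x <;> rfl

theorem Sub.id_up : (Sub.id (Γ := Γ)).up (B := B) = Sub.id := by
  funext A x
  cases x <;> rfl

mutual

theorem Val.rename_eq_subst {Γ Δ : Ctx Op} {A : Ty Op} :
    ∀ (V : Val Γ A) (ρ : Ren Γ Δ), V.rename ρ = V.subst ρ.toSub
  | .var x, ρ => by simp only [Val.rename, Val.subst, Ren.toSub]
  | .lam M, ρ => by
      simp only [Val.rename, Val.subst, ← Ren.toSub_up, Comp.rename_eq_subst M]
  | .tuple V, ρ => by
      simp only [Val.rename, Val.subst, fun i => Val.rename_eq_subst (V i) ρ]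
  | .proj (A := _) i V, ρ => by simp only [Val.rename, Val.subst, Val.rename_eq_subst V]

theorem Comp.rename_eq_subst {Γ Δ : Ctx Op} {C : CTy Op} :
    ∀ (M : Comp Γ C) (ρ : Ren Γ Δ), M.rename ρ = M.subst ρ.toSub
  | .app V W, ρ => by
      simp only [Comp.rename, Comp.subst, Val.rename_eq_subst V, Val.rename_eq_subst W]
  | .ret V, ρ => by simp only [Comp.rename, Comp.subst, Val.rename_eq_subst V]
  | .letIn M N, ρ => by
      simp only [Comp.rename, Comp.subst, ← Ren.toSub_up, Comp.rename_eq_subst M,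
        Comp.rename_eq_subst N]
  | .op o V, ρ => by simp only [Comp.rename, Comp.subst, Val.rename_eq_subst V]
  | .handle M H N, ρ => by
      simp only [Comp.rename, Comp.subst, ← Ren.toSub_up, Comp.rename_eq_subst M,
        Handler.rename_eq_subst H, Comp.rename_eq_subst N]

theorem Handler.rename_eq_subst {Γ Δ : Ctx Op} {S : Sig Op} {C : CTy Op} :
    ∀ (H : Handler Γ S C) (ρ : Ren Γ Δ), H.rename ρ = H.subst ρ.toSub
  | .mk M, ρ => by
      simp only [Handler.rename, Handler.subst, ← Ren.toSub_up,
        fun o => Comp.rename_eq_subst (M o) ρ.up.up]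

end

mutual

theorem Val.subst_id {Γ : Ctx Op} {A : Ty Op} : ∀ V : Val Γ A, V.subst Sub.id = V
  | .var x => by simp only [Val.subst, Sub.id]
  | .lam M => by simp only [Val.subst, Sub.id_up, Comp.subst_id M]
  | .tuple V => by simp only [Val.subst, fun i => Val.subst_id (V i)]
  | .proj (A := _) i V => by simp only [Val.subst, Val.subst_id V]

theorem Comp.subst_id {Γ : Ctx Op} {C : CTy Op} : ∀ M : Comp Γ C, M.subst Sub.id = M
  | .app V W => by simp only [Comp.subst, Val.subst_id V, Val.subst_id W]
  | .ret V => by simp only [Comp.subst, Val.subst_id V]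
  | .letIn M N => by simp only [Comp.subst, Sub.id_up, Comp.subst_id M, Comp.subst_id N]
  | .op o V => by simp only [Comp.subst, Val.subst_id V]
  | .handle M H N => by
      simp only [Comp.subst, Sub.id_up, Comp.subst_id M, Handler.subst_id H, Comp.subst_id N]

theorem Handler.subst_id {Γ : Ctx Op} {S : Sig Op} {C : CTy Op} :
    ∀ H : Handler Γ S C, H.subst Sub.id = H
  | .mk M => by simp only [Handler.subst, Sub.id_up, fun o => Comp.subst_id (M o)]

end

/-- A relation on composable pairs of substitutions is *liftable* if it is preserved by extension
under a binder, and if this extension respects the composition of related pairs. The composition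
law for substitutions is proved once for a liftable relation and then used for successively larger
ones: renamings on the left, renamings on the right, and all pairs. -/
def Sub.Liftable (P : ∀ ⦃Γ Δ Θ : Ctx Op⦄, Sub Γ Δ → Sub Δ Θ → Prop) : Prop :=
  ∀ ⦃Γ Δ Θ : Ctx Op⦄ ⦃σ : Sub Γ Δ⦄ ⦃τ : Sub Δ Θ⦄, P σ τ → ∀ B : Ty Op,
    P (σ.up (B := B)) τ.up ∧ (σ.up (B := B)).comp τ.up = (σ.comp τ).up

mutual

theorem Val.subst_subst_of_liftable {P : ∀ ⦃Γ Δ Θ : Ctx Op⦄, Sub Γ Δ → Sub Δ Θ → Prop}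
    (hP : Sub.Liftable P) {Γ Δ Θ : Ctx Op} {A : Ty Op} :
    ∀ (V : Val Γ A) {σ : Sub Γ Δ} {τ : Sub Δ Θ}, P σ τ →
      (V.subst σ).subst τ = V.subst (σ.comp τ)
  | .var x, _, _, _ => by simp only [Val.subst, Sub.comp]
  | .lam M, _, _, h => by
      simp only [Val.subst, M.subst_subst_of_liftable hP (hP h _).1, (hP h _).2]
  | .tuple V, _, _, h => by
      simp only [Val.subst, fun i => (V i).subst_subst_of_liftable hP h]
  | .proj (A := _) i V, _, _, h => by simp only [Val.subst, V.subst_subst_of_liftable hP h]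

theorem Comp.subst_subst_of_liftable {P : ∀ ⦃Γ Δ Θ : Ctx Op⦄, Sub Γ Δ → Sub Δ Θ → Prop}
    (hP : Sub.Liftable P) {Γ Δ Θ : Ctx Op} {C : CTy Op} :
    ∀ (M : Comp Γ C) {σ : Sub Γ Δ} {τ : Sub Δ Θ}, P σ τ →
      (M.subst σ).subst τ = M.subst (σ.comp τ)
  | .app V W, _, _, h => by
      simp only [Comp.subst, V.subst_subst_of_liftable hP h, W.subst_subst_of_liftable hP h]
  | .ret V, _, _, h => by simp only [Comp.subst, V.subst_subst_of_liftable hP h]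
  | .letIn M N, _, _, h => by
      simp only [Comp.subst, M.subst_subst_of_liftable hP h,
        N.subst_subst_of_liftable hP (hP h _).1, (hP h _).2]
  | .op o V, _, _, h => by simp only [Comp.subst, V.subst_subst_of_liftable hP h]
  | .handle M H N, _, _, h => by
      simp only [Comp.subst, M.subst_subst_of_liftable hP h, H.subst_subst_of_liftable hP h,
        N.subst_subst_of_liftable hP (hP h _).1, (hP h _).2]

theorem Handler.subst_subst_of_liftable {P : ∀ ⦃Γ Δ Θ : Ctx Op⦄, Sub Γ Δ → Sub Δ Θ → Prop}
    (hP : Sub.Liftable P) {Γ Δ Θ : Ctx Op} {S : Sig Op} {C : CTy Op} :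
    ∀ (H : Handler Γ S C) {σ : Sub Γ Δ} {τ : Sub Δ Θ}, P σ τ →
      (H.subst σ).subst τ = H.subst (σ.comp τ)
  | .mk M, _, _, h => by
      simp only [Handler.subst, fun o =>
        (M o).subst_subst_of_liftable hP (hP (hP h _).1 _).1, (hP h _).2, (hP (hP h _).1 _).2]

end

theorem Sub.liftable_toSub_left :
    Sub.Liftable fun (Γ Δ Θ : Ctx Op) (σ : Sub Γ Δ) (_ : Sub Δ Θ) =>
      ∃ ρ : Ren Γ Δ, σ = ρ.toSub := by
  rintro Γ Δ Θ _ τ ⟨ρ, rfl⟩ B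
  refine ⟨⟨ρ.up, (Ren.toSub_up ρ).symm⟩, ?_⟩
  funext A x
  cases x <;> rfl

theorem Val.rename_subst (V : Val Γ A) (ρ : Ren Γ Δ) (τ : Sub Δ Θ) :
    (V.rename ρ).subst τ = V.subst (ρ.toSub.comp τ) := by
  rw [Val.rename_eq_subst]
  exact V.subst_subst_of_liftable Sub.liftable_toSub_left ⟨ρ, rfl⟩

theorem Sub.wk_comp_up (σ : Sub Γ Δ) :
    (Ren.wk (B := B)).toSub.comp σ.up = σ.comp Ren.wk.toSub := by
  funext A x
  exact (σ x).rename_eq_subst Ren.wk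

theorem Sub.liftable_toSub_right :
    Sub.Liftable fun (Γ Δ Θ : Ctx Op) (_ : Sub Γ Δ) (τ : Sub Δ Θ) =>
      ∃ ρ : Ren Δ Θ, τ = ρ.toSub := by
  rintro Γ Δ Θ σ _ ⟨ρ, rfl⟩ B
  refine ⟨⟨ρ.up, (Ren.toSub_up ρ).symm⟩, ?_⟩
  funext A x
  cases x with
  | zero => rfl
  | succ x =>
    change ((σ x).rename Ren.wk).subst ρ.toSub.up = ((σ x).subst ρ.toSub).rename Ren.wk
    rw [Val.rename_subst, ← Val.rename_eq_subst _ ρ, Val.rename_eq_subst _ Ren.wk,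
      Val.rename_subst, Sub.wk_comp_up]

theorem Val.subst_rename (V : Val Γ A) (σ : Sub Γ Δ) (ρ : Ren Δ Θ) :
    (V.subst σ).rename ρ = V.subst (σ.comp ρ.toSub) := by
  rw [Val.rename_eq_subst]
  exact V.subst_subst_of_liftable Sub.liftable_toSub_right ⟨ρ, rfl⟩

theorem Sub.up_comp_up (σ : Sub Γ Δ) (τ : Sub Δ Θ) :
    (σ.up (B := B)).comp τ.up = (σ.comp τ).up := by
  funext A x
  cases x with
  | zero => rfl
  | succ x =>
    change ((σ x).rename Ren.wk).subst τ.up = ((σ x).subst τ).rename Ren.wk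
    rw [Val.rename_subst, Val.subst_rename, Sub.wk_comp_up]

theorem Sub.liftable_true :
    Sub.Liftable fun (Γ Δ Θ : Ctx Op) (_ : Sub Γ Δ) (_ : Sub Δ Θ) => True :=
  fun _ _ _ σ τ _ _ => ⟨trivial, σ.up_comp_up τ⟩

theorem Val.subst_subst (V : Val Γ A) (σ : Sub Γ Δ) (τ : Sub Δ Θ) :
    (V.subst σ).subst τ = V.subst (σ.comp τ) :=
  V.subst_subst_of_liftable Sub.liftable_true trivial

theorem Comp.subst_subst (M : Comp Γ C) (σ : Sub Γ Δ) (τ : Sub Δ Θ) :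
    (M.subst σ).subst τ = M.subst (σ.comp τ) :=
  M.subst_subst_of_liftable Sub.liftable_true trivial

theorem Handler.subst_subst (H : Handler Γ S C) (σ : Sub Γ Δ) (τ : Sub Δ Θ) :
    (H.subst σ).subst τ = H.subst (σ.comp τ) :=
  H.subst_subst_of_liftable Sub.liftable_true trivial

theorem Sub.wk_comp_cons (σ : Sub Γ Δ) (V : Val Δ B) : Ren.wk.toSub.comp (σ.cons V) = σ := rfl

theorem Sub.up_comp_cons (σ : Sub Γ Δ) (τ : Sub Δ Θ) (V : Val Θ B) :
    σ.up.comp (τ.cons V) = (σ.comp τ).cons V := by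
  funext A x
  cases x with
  | zero => rfl
  | succ x =>
    change ((σ x).rename Ren.wk).subst (τ.cons V) = (σ x).subst τ
    rw [Val.rename_subst, Sub.wk_comp_cons]

theorem Sub.cons_comp (σ : Sub Γ Δ) (V : Val Δ B) (τ : Sub Δ Θ) :
    (σ.cons V).comp τ = (σ.comp τ).cons (V.subst τ) := by
  funext A x
  cases x <;> rfl

theorem Sub.id_comp (σ : Sub Γ Δ) : Sub.id.comp σ = σ := rfl

theorem Sub.comp_id (σ : Sub Γ Δ) : σ.comp Sub.id = σ := by
  funext A x
  exact Val.subst_id _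

theorem Comp.inst_subst (M : Comp (A :: Γ) C) (V : Val Γ A) (σ : Sub Γ Δ) :
    (M.inst V).subst σ = (M.subst σ.up).inst (V.subst σ) := by
  simp only [Comp.inst, Comp.subst_subst, Sub.cons_comp, Sub.up_comp_cons, Sub.id_comp,
    Sub.comp_id]

theorem Comp.inst₂_subst (M : Comp (B :: A :: Γ) C) (V : Val Γ A) (W : Val Γ B) (σ : Sub Γ Δ) :
    (M.inst₂ V W).subst σ = (M.subst σ.up.up).inst₂ (V.subst σ) (W.subst σ) := by
  simp only [Comp.inst₂, Comp.subst_subst, Sub.cons_comp, Sub.up_comp_cons, Sub.id_comp,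
    Sub.comp_id]

theorem Val.rename_wk_subst_up (V : Val Γ A) (σ : Sub Γ Δ) :
    (V.rename (Ren.wk (B := B))).subst σ.up = (V.subst σ).rename Ren.wk := by
  rw [Val.rename_subst, Val.subst_rename, Sub.wk_comp_up]

theorem Handler.rename_wk_subst_up (H : Handler Γ S C) (σ : Sub Γ Δ) :
    (H.rename (Ren.wk (B := B))).subst σ.up = (H.subst σ).rename Ren.wk := by
  simp only [Handler.rename_eq_subst, Handler.subst_subst, Sub.wk_comp_up]

theorem Comp.rename_up_wk_subst_up (M : Comp (A :: Γ) C) (σ : Sub Γ Δ) :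
    (M.rename (Ren.up (Ren.wk (B := B)))).subst σ.up.up =
      (M.subst σ.up).rename (Ren.up Ren.wk) := by
  simp only [Comp.rename_eq_subst, Comp.subst_subst, Ren.toSub_up, Sub.up_comp_up, Sub.wk_comp_up]

end Substitution

/-! ### Stability of the equational theory under substitution -/

mutual

theorem ValEq.subst : ∀ {Γ Δ : Ctx Op} {A : Ty Op} {V W : Val Γ A} (σ : Sub Γ Δ),
    ValEq V W → ValEq (V.subst σ) (W.subst σ)
  | _, _, _, _, _, _, .refl _ => .refl _
  | _, _, _, _, _, σ, .symm h => .symm (h.subst σ)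
  | _, _, _, _, _, σ, .trans h h' => .trans (h.subst σ) (h'.subst σ)
  | _, _, _, _, _, σ, .lam_congr h => by
    simpa only [Val.subst] using .lam_congr (h.subst σ.up)
  | _, _, _, _, _, σ, .tuple_congr h => by
    simpa only [Val.subst] using .tuple_congr fun i => (h i).subst σ
  | _, _, _, _, _, σ, .proj_congr (A := _) i h => by
    simpa only [Val.subst] using .proj_congr i (h.subst σ)
  | _, _, _, _, _, σ, .abs_eta _ => by
    simpa only [Val.subst, Comp.subst, Val.rename_wk_subst_up] using .abs_eta _
  | _, _, _, _, _, σ, .prod_beta (A := _) i V => by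
    simpa only [Val.subst] using .prod_beta i fun j => (V j).subst σ
  | _, _, _, _, _, σ, .prod_eta _ => by simpa only [Val.subst] using .prod_eta _

theorem CompEq.subst : ∀ {Γ Δ : Ctx Op} {C : CTy Op} {M N : Comp Γ C} (σ : Sub Γ Δ),
    CompEq M N → CompEq (M.subst σ) (N.subst σ)
  | _, _, _, _, _, _, .refl _ => .refl _
  | _, _, _, _, _, σ, .symm h => .symm (h.subst σ)
  | _, _, _, _, _, σ, .trans h h' => .trans (h.subst σ) (h'.subst σ)
  | _, _, _, _, _, σ, .app_congr h h' => by
    simpa only [Comp.subst] using .app_congr (h.subst σ) (h'.subst σ)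
  | _, _, _, _, _, σ, .ret_congr h => by simpa only [Comp.subst] using .ret_congr (h.subst σ)
  | _, _, _, _, _, σ, .let_congr h h' => by
    simpa only [Comp.subst] using .let_congr (h.subst σ) (h'.subst σ.up)
  | _, _, _, _, _, σ, .op_congr o h => by simpa only [Comp.subst] using .op_congr o (h.subst σ)
  | _, _, _, _, _, σ, .handle_congr h h' h'' => by
    simpa only [Comp.subst] using .handle_congr (h.subst σ) (h'.subst σ) (h''.subst σ.up)
  | _, _, _, _, _, σ, .abs_beta M V => by
    simpa only [Comp.inst_subst, Comp.subst, Val.subst] using .abs_beta _ _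
  | _, _, _, _, _, σ, .ret_let V M => by
    simpa only [Comp.inst_subst, Comp.subst] using .ret_let _ _
  | _, _, _, _, _, σ, .let_let M N L => by
    simpa only [Comp.subst, Comp.rename_up_wk_subst_up] using .let_let _ _ _
  | _, _, _, _, _, σ, .let_ret M => by simpa only [Comp.subst] using .let_ret _
  | _, _, _, _, _, σ, .handle_ret V H M => by
    simpa only [Comp.inst_subst, Comp.subst] using .handle_ret _ _ _
  | _, _, _, _, _, σ, .handle_let H L M N => by
    simpa only [Comp.subst, Comp.rename_up_wk_subst_up, Handler.rename_wk_subst_up]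
      using .handle_let _ _ _ _
  | _, _, _, _, _, σ, .handle_op o H M V => by
    simpa only [Comp.inst₂_subst, Comp.subst, Handler.subst, Val.subst]
      using .handle_op o (fun o => (H o).subst σ.up.up) _ _

theorem HandlerEq.subst : ∀ {Γ Δ : Ctx Op} {S : Sig Op} {C : CTy Op} {H H' : Handler Γ S C}
    (σ : Sub Γ Δ), HandlerEq H H' → HandlerEq (H.subst σ) (H'.subst σ)
  | _, _, _, _, _, _, _, .refl _ => .refl _
  | _, _, _, _, _, _, σ, .symm h => .symm (h.subst σ)
  | _, _, _, _, _, _, σ, .trans h h' => .trans (h.subst σ) (h'.subst σ)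
  | _, _, _, _, _, _, σ, .congr h => by
    simpa only [Handler.subst] using .congr fun o => (h o).subst σ.up.up

end

/-- Pointwise derivable equality of substitutions. -/
def SubEq {Γ Δ : Ctx Op} (σ τ : Sub Γ Δ) : Prop := ∀ ⦃A : Ty Op⦄ (x : Var Γ A), ValEq (σ x) (τ x)

theorem SubEq.up {Γ Δ : Ctx Op} {B : Ty Op} {σ τ : Sub Γ Δ} (h : SubEq σ τ) :
    SubEq (σ.up (B := B)) τ.up
  | _, .zero => .refl _
  | _, .succ x => by simpa only [Sub.up, Val.rename_eq_subst] using (h x).subst Ren.wk.toSub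

mutual

theorem Val.subst_congr {Γ Δ : Ctx Op} {A : Ty Op} :
    ∀ (V : Val Γ A) {σ τ : Sub Γ Δ}, SubEq σ τ → ValEq (V.subst σ) (V.subst τ)
  | .var x, _, _, h => by simpa only [Val.subst] using h x
  | .lam M, _, _, h => by simpa only [Val.subst] using .lam_congr (M.subst_congr h.up)
  | .tuple V, _, _, h => by
      simpa only [Val.subst] using .tuple_congr fun i => (V i).subst_congr h
  | .proj (A := _) i V, _, _, h => by
      simpa only [Val.subst] using .proj_congr i (V.subst_congr h)

theorem Comp.subst_congr {Γ Δ : Ctx Op} {C : CTy Op} :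
    ∀ (M : Comp Γ C) {σ τ : Sub Γ Δ}, SubEq σ τ → CompEq (M.subst σ) (M.subst τ)
  | .app V W, _, _, h => by
      simpa only [Comp.subst] using .app_congr (V.subst_congr h) (W.subst_congr h)
  | .ret V, _, _, h => by simpa only [Comp.subst] using .ret_congr (V.subst_congr h)
  | .letIn M N, _, _, h => by
      simpa only [Comp.subst] using .let_congr (M.subst_congr h) (N.subst_congr h.up)
  | .op o V, _, _, h => by simpa only [Comp.subst] using .op_congr o (V.subst_congr h)
  | .handle M H N, _, _, h => by
      simpa only [Comp.subst] using
        .handle_congr (M.subst_congr h) (H.subst_congr h) (N.subst_congr h.up)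

theorem Handler.subst_congr {Γ Δ : Ctx Op} {S : Sig Op} {C : CTy Op} :
    ∀ (H : Handler Γ S C) {σ τ : Sub Γ Δ}, SubEq σ τ → HandlerEq (H.subst σ) (H.subst τ)
  | .mk M, _, _, h => by
      simpa only [Handler.subst] using .congr fun o => (M o).subst_congr h.up.up

end

/-! ### Terms modulo derivable equality -/

section Quotient

variable {Γ Δ Θ Ξ : Ctx Op} {A B : Ty Op} {n : ℕ} {F : Fin n → Ty Op} {C : CTy Op} {S : Sig Op}

/-- Derivable equality of value terms. -/
def valSetoid (Γ : Ctx Op) (A : Ty Op) : Setoid (Val Γ A) where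
  r := ValEq
  iseqv := ⟨.refl, .symm, .trans⟩

/-- Derivable equality of computation terms. -/
def compSetoid (Γ : Ctx Op) (C : CTy Op) : Setoid (Comp Γ C) where
  r := CompEq
  iseqv := ⟨.refl, .symm, .trans⟩

/-- Value terms modulo derivable equality. -/
def QVal (Γ : Ctx Op) (A : Ty Op) : Type u := Quotient (valSetoid Γ A)

/-- Computation terms modulo derivable equality. -/
def QComp (Γ : Ctx Op) (C : CTy Op) : Type u := Quotient (compSetoid Γ C)

/-- Handlers modulo derivable equality, as families of clauses. -/
abbrev QHandler (Γ : Ctx Op) (S : Sig Op) (C : CTy Op) : Type u :=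
  ∀ o : {o // o ∈ S.dom}, QComp (Ty.fn (S.res o) C :: S.arg o :: Γ) C

/-- Substitutions of classes of value terms over `Δ` for the variables of `Γ`. -/
def QSub (Γ Δ : Ctx Op) : Type u := ∀ ⦃A : Ty Op⦄, Var Γ A → QVal Δ A

/-- The class of a value term. -/
def QVal.mk (V : Val Γ A) : QVal Γ A := Quotient.mk (valSetoid Γ A) V

/-- The class of a computation term. -/
def QComp.mk (M : Comp Γ C) : QComp Γ C := Quotient.mk (compSetoid Γ C) M

/-- The pointwise class of a substitution. -/
def QSub.mk (σ : Sub Γ Δ) : QSub Γ Δ := fun _ x => .mk (σ x)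

/-- A representative of a class of value terms; choosing one makes it possible to define the
constructors, which may take a family of arguments, on classes. -/
noncomputable def QVal.out (V : QVal Γ A) : Val Γ A := Quotient.out V

/-- A representative of a class of computation terms. -/
noncomputable def QComp.out (M : QComp Γ C) : Comp Γ C := Quotient.out M

theorem QVal.mk_eq {V W : Val Γ A} : mk V = mk W ↔ ValEq V W :=
  ⟨fun h => Quotient.exact h, fun h => Quotient.sound (s := valSetoid Γ A) h⟩

theorem QComp.mk_eq {M N : Comp Γ C} : mk M = mk N ↔ CompEq M N :=
  ⟨fun h => Quotient.exact h, fun h => Quotient.sound (s := compSetoid Γ C) h⟩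

theorem QVal.mk_out (V : QVal Γ A) : mk V.out = V := Quotient.out_eq V

theorem QComp.mk_out (M : QComp Γ C) : mk M.out = M := Quotient.out_eq M

theorem QVal.out_mk (V : Val Γ A) : ValEq (mk V).out V := mk_eq.1 (mk_out _)

theorem QComp.out_mk (M : Comp Γ C) : CompEq (mk M).out M := mk_eq.1 (mk_out _)

theorem QVal.exists_rep (V : QVal Γ A) : ∃ V', V = mk V' := ⟨_, (mk_out V).symm⟩

theorem QComp.exists_rep (M : QComp Γ C) : ∃ M', M = mk M' := ⟨_, (mk_out M).symm⟩

theorem QVal.exists_rep_family {ι : Type*} {A : ι → Ty Op} (V : ∀ i, QVal Γ (A i)) :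
    ∃ V' : ∀ i, Val Γ (A i), V = fun i => mk (V' i) :=
  ⟨fun i => (V i).out, funext fun i => (mk_out (V i)).symm⟩

theorem QHandler.exists_rep (H : QHandler Γ S C) :
    ∃ M : ∀ o : {o // o ∈ S.dom}, Comp (Ty.fn (S.res o) C :: S.arg o :: Γ) C,
      H = fun o => .mk (M o) :=
  ⟨fun o => (H o).out, funext fun o => (QComp.mk_out (H o)).symm⟩

theorem QSub.exists_rep (σ : QSub Γ Δ) : ∃ σ', σ = mk σ' :=
  ⟨fun _ x => (σ x).out, funext fun _ => funext fun _ => (QVal.mk_out _).symm⟩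

namespace QVal

/-- Variables, modulo derivable equality. -/
def var (x : Var Γ A) : QVal Γ A := mk (.var x)

/-- The last variable of a context. -/
def last : QVal (A :: Γ) A := var .zero

/-- Abstraction, modulo derivable equality. -/
noncomputable def lam (M : QComp (A :: Γ) C) : QVal Γ (Ty.fn A C) := mk (.lam M.out)

/-- Tupling, modulo derivable equality. -/
noncomputable def tuple (V : ∀ i, QVal Γ (F i)) : QVal Γ (Ty.prod F) :=
  mk (.tuple fun i => (V i).out)

/-- Projections, modulo derivable equality. -/
noncomputable def proj (i : Fin n) (V : QVal Γ (Ty.prod F)) : QVal Γ (F i) := mk (.proj i V.out)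

theorem mk_lam (M : Comp (A :: Γ) C) : mk (.lam M) = lam (.mk M) :=
  mk_eq.2 (.lam_congr (QComp.out_mk M).symm)

theorem mk_tuple (V : ∀ i, Val Γ (F i)) : mk (.tuple V) = tuple fun i => mk (V i) :=
  mk_eq.2 (.tuple_congr fun i => (out_mk (V i)).symm)

theorem mk_proj (i : Fin n) (V : Val Γ (Ty.prod F)) : mk (.proj i V) = proj i (mk V) :=
  mk_eq.2 (.proj_congr i (out_mk V).symm)

end QVal

namespace QComp

/-- Application, modulo derivable equality. -/
noncomputable def app (V : QVal Γ (Ty.fn A C)) (W : QVal Γ A) : QComp Γ C :=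
  mk (.app V.out W.out)

/-- Returning a value, modulo derivable equality. -/
noncomputable def ret (V : QVal Γ A) : QComp Γ ⟨A, S⟩ := mk (.ret V.out)

/-- Sequencing, modulo derivable equality. -/
noncomputable def letIn (M : QComp Γ ⟨A, S⟩) (N : QComp (A :: Γ) ⟨B, S⟩) : QComp Γ ⟨B, S⟩ :=
  mk (.letIn M.out N.out)

/-- Calling an operation, modulo derivable equality. -/
noncomputable def op (o : {o // o ∈ S.dom}) (V : QVal Γ (S.arg o)) : QComp Γ ⟨S.res o, S⟩ :=
  mk (.op o V.out)

/-- Handling, modulo derivable equality. -/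
noncomputable def handle (M : QComp Γ ⟨A, S⟩) (H : QHandler Γ S C) (N : QComp (A :: Γ) C) :
    QComp Γ C :=
  mk (.handle M.out (.mk fun o => (H o).out) N.out)

theorem mk_app (V : Val Γ (Ty.fn A C)) (W : Val Γ A) : mk (.app V W) = app (.mk V) (.mk W) :=
  mk_eq.2 (.app_congr (QVal.out_mk V).symm (QVal.out_mk W).symm)

theorem mk_ret (V : Val Γ A) : mk (.ret (S := S) V) = ret (.mk V) :=
  mk_eq.2 (.ret_congr (QVal.out_mk V).symm)

theorem mk_letIn (M : Comp Γ ⟨A, S⟩) (N : Comp (A :: Γ) ⟨B, S⟩) :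
    mk (.letIn M N) = letIn (mk M) (mk N) :=
  mk_eq.2 (.let_congr (out_mk M).symm (out_mk N).symm)

theorem mk_op (o : {o // o ∈ S.dom}) (V : Val Γ (S.arg o)) : mk (.op o V) = op o (.mk V) :=
  mk_eq.2 (.op_congr o (QVal.out_mk V).symm)

theorem mk_handle (M : Comp Γ ⟨A, S⟩)
    (H : ∀ o : {o // o ∈ S.dom}, Comp (Ty.fn (S.res o) C :: S.arg o :: Γ) C)
    (N : Comp (A :: Γ) C) :
    mk (.handle M (.mk H) N) = handle (mk M) (fun o => mk (H o)) (mk N) :=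
  mk_eq.2 (.handle_congr (out_mk M).symm (.congr fun o => (out_mk (H o)).symm) (out_mk N).symm)

end QComp

/-- Substitution in value terms, modulo derivable equality. -/
noncomputable def QVal.subst (V : QVal Γ A) (σ : QSub Γ Δ) : QVal Δ A :=
  mk (V.out.subst fun _ x => (σ x).out)

/-- Substitution in computation terms, modulo derivable equality. -/
noncomputable def QComp.subst (M : QComp Γ C) (σ : QSub Γ Δ) : QComp Δ C :=
  mk (M.out.subst fun _ x => (σ x).out)

theorem QVal.mk_subst (V : Val Γ A) (σ : Sub Γ Δ) : mk (V.subst σ) = (mk V).subst (.mk σ) :=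
  mk_eq.2 ((V.subst_congr fun _ x => (out_mk (σ x)).symm).trans ((out_mk V).symm.subst _))

theorem QComp.mk_subst (M : Comp Γ C) (σ : Sub Γ Δ) : mk (M.subst σ) = (mk M).subst (.mk σ) :=
  mk_eq.2 ((M.subst_congr fun _ x => (QVal.out_mk (σ x)).symm).trans ((out_mk M).symm.subst _))

namespace QSub

/-- The empty substitution. -/
def nil : QSub [] Δ := fun _ x => nomatch x

/-- The identity substitution. -/
def id : QSub Γ Γ := fun _ x => .var x

/-- The weakening substitution. -/
def wk : QSub Γ (B :: Γ) := fun _ x => .var (.succ x)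

/-- The substitution that maps the last variable to `V` and is `σ` on the others. -/
def cons (σ : QSub Γ Δ) (V : QVal Δ B) : QSub (B :: Γ) Δ
  | _, .zero => V
  | _, .succ x => σ x

/-- Composition of substitutions, in diagrammatic order. -/
noncomputable def comp (σ : QSub Γ Δ) (τ : QSub Δ Θ) : QSub Γ Θ := fun _ x => (σ x).subst τ

/-- Extension of a substitution under a binder. -/
@[simp] noncomputable def up (σ : QSub Γ Δ) : QSub (B :: Γ) (B :: Δ) := (σ.comp wk).cons .last

theorem mk_id : mk (Sub.id (Γ := Γ)) = id := rfl

theorem mk_wk : mk (Ren.wk (Γ := Γ) (B := B)).toSub = wk := rfl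

theorem mk_cons (σ : Sub Γ Δ) (V : Val Δ B) : mk (σ.cons V) = (mk σ).cons (.mk V) := by
  funext A x
  cases x <;> rfl

theorem mk_comp (σ : Sub Γ Δ) (τ : Sub Δ Θ) : mk (σ.comp τ) = (mk σ).comp (mk τ) := by
  funext A x
  exact QVal.mk_subst _ _

theorem mk_up (σ : Sub Γ Δ) : mk (σ.up (B := B)) = (mk σ).up := by
  funext A x
  cases x with
  | zero => rfl
  | succ x =>
    change QVal.mk ((σ x).rename Ren.wk) = (QVal.mk (σ x)).subst wk
    rw [Val.rename_eq_subst, QVal.mk_subst, mk_wk]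

end QSub

/-! ### The calculus of explicit substitutions -/

@[simp] theorem QVal.subst_subst (V : QVal Γ A) (σ : QSub Γ Δ) (τ : QSub Δ Θ) :
    (V.subst σ).subst τ = V.subst (σ.comp τ) := by
  obtain ⟨V, rfl⟩ := V.exists_rep
  obtain ⟨σ, rfl⟩ := σ.exists_rep
  obtain ⟨τ, rfl⟩ := τ.exists_rep
  simp only [← QVal.mk_subst, ← QSub.mk_comp, Val.subst_subst]

@[simp] theorem QComp.subst_subst (M : QComp Γ C) (σ : QSub Γ Δ) (τ : QSub Δ Θ) :
    (M.subst σ).subst τ = M.subst (σ.comp τ) := by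
  obtain ⟨M, rfl⟩ := M.exists_rep
  obtain ⟨σ, rfl⟩ := σ.exists_rep
  obtain ⟨τ, rfl⟩ := τ.exists_rep
  simp only [← QComp.mk_subst, ← QSub.mk_comp, Comp.subst_subst]

@[simp] theorem QVal.subst_id (V : QVal Γ A) : V.subst .id = V := by
  obtain ⟨V, rfl⟩ := V.exists_rep
  rw [← QSub.mk_id, ← QVal.mk_subst, Val.subst_id]

@[simp] theorem QComp.subst_id (M : QComp Γ C) : M.subst .id = M := by
  obtain ⟨M, rfl⟩ := M.exists_rep
  rw [← QSub.mk_id, ← QComp.mk_subst, Comp.subst_id]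

theorem QVal.var_subst (x : Var Γ A) (σ : QSub Γ Δ) : (var x).subst σ = σ x := by
  obtain ⟨σ, rfl⟩ := σ.exists_rep
  rw [var, ← QVal.mk_subst, Val.subst]
  rfl

@[simp] theorem QVal.last_subst_cons (σ : QSub Γ Δ) (V : QVal Δ A) :
    last.subst (σ.cons V) = V := var_subst _ _

namespace QSub

@[simp] theorem comp_assoc (σ : QSub Γ Δ) (τ : QSub Δ Θ) (υ : QSub Θ Ξ) :
    (σ.comp τ).comp υ = σ.comp (τ.comp υ) := by
  funext A x
  exact QVal.subst_subst _ _ _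

@[simp] theorem id_comp (σ : QSub Γ Δ) : id.comp σ = σ := by
  funext A x
  exact QVal.var_subst _ _

@[simp] theorem comp_id (σ : QSub Γ Δ) : σ.comp id = σ := by
  funext A x
  exact QVal.subst_id _

@[simp] theorem wk_comp_cons (σ : QSub Γ Δ) (V : QVal Δ B) : wk.comp (σ.cons V) = σ := by
  funext A x
  exact QVal.var_subst _ _

@[simp] theorem cons_comp (σ : QSub Γ Δ) (V : QVal Δ B) (τ : QSub Δ Θ) :
    (σ.cons V).comp τ = (σ.comp τ).cons (V.subst τ) := by
  funext A x
  cases x <;> rfl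

theorem eq_nil (σ τ : QSub [] Δ) : σ = τ := by
  funext A x
  cases x

@[simp] theorem nil_comp (τ : QSub Δ Θ) : nil.comp τ = nil := eq_nil _ _

@[simp] theorem wk_eq_nil : (wk : QSub [] [B]) = nil := eq_nil _ _

@[simp] theorem cons_wk_last : (wk : QSub Γ (B :: Γ)).cons .last = id := by
  funext A x
  cases x <;> rfl

@[simp] theorem cons_wk_comp_last (σ : QSub (B :: Γ) Δ) :
    (wk.comp σ).cons (QVal.last.subst σ) = σ := by
  rw [← cons_comp, cons_wk_last, id_comp]

@[simp] theorem cons_nil_last : (nil : QSub [] [B]).cons .last = id := by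
  rw [← wk_eq_nil, cons_wk_last]

@[simp] theorem cons_nil_last_subst (σ : QSub [B] Δ) : nil.cons (QVal.last.subst σ) = σ := by
  rw [eq_nil nil (wk.comp σ), cons_wk_comp_last]

end QSub

namespace QVal

@[simp] theorem lam_subst (M : QComp (A :: Γ) C) (σ : QSub Γ Δ) :
    (lam M).subst σ = lam (M.subst σ.up) := by
  obtain ⟨M, rfl⟩ := M.exists_rep
  obtain ⟨σ, rfl⟩ := σ.exists_rep
  simp only [← mk_lam, ← mk_subst, ← QComp.mk_subst, ← QSub.mk_up, Val.subst]

@[simp] theorem tuple_subst (V : ∀ i, QVal Γ (F i)) (σ : QSub Γ Δ) :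
    (tuple V).subst σ = tuple fun i => (V i).subst σ := by
  obtain ⟨V, rfl⟩ := exists_rep_family V
  obtain ⟨σ, rfl⟩ := σ.exists_rep
  simp only [← mk_tuple, ← mk_subst, Val.subst]

@[simp] theorem proj_subst (i : Fin n) (V : QVal Γ (Ty.prod F)) (σ : QSub Γ Δ) :
    (proj i V).subst σ = proj i (V.subst σ) := by
  obtain ⟨V, rfl⟩ := V.exists_rep
  obtain ⟨σ, rfl⟩ := σ.exists_rep
  simp only [← mk_proj, ← mk_subst, Val.subst]

@[simp] theorem proj_tuple (i : Fin n) (V : ∀ i, QVal Γ (F i)) : proj i (tuple V) = V i := by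
  obtain ⟨V, rfl⟩ := exists_rep_family V
  rw [← mk_tuple, ← mk_proj]
  exact mk_eq.2 (.prod_beta i V)

theorem tuple_proj (V : QVal Γ (Ty.prod F)) : tuple (fun i => proj i V) = V := by
  obtain ⟨V, rfl⟩ := V.exists_rep
  simp only [← mk_tuple, ← mk_proj]
  exact mk_eq.2 (ValEq.prod_eta V).symm

theorem prod_ext {V W : QVal Γ (Ty.prod F)} (h : ∀ i, proj i V = proj i W) : V = W := by
  rw [← tuple_proj V, ← tuple_proj W]
  exact congrArg tuple (funext h)

theorem lam_app (V : QVal Γ (Ty.fn A C)) : lam (.app (V.subst .wk) last) = V := by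
  obtain ⟨V, rfl⟩ := V.exists_rep
  rw [last, var, ← QSub.mk_wk, ← mk_subst, ← Val.rename_eq_subst, ← QComp.mk_app, ← mk_lam]
  exact mk_eq.2 (ValEq.abs_eta V).symm

end QVal

namespace QComp

@[simp] theorem app_subst (V : QVal Γ (Ty.fn A C)) (W : QVal Γ A) (σ : QSub Γ Δ) :
    (app V W).subst σ = app (V.subst σ) (W.subst σ) := by
  obtain ⟨V, rfl⟩ := V.exists_rep
  obtain ⟨W, rfl⟩ := W.exists_rep
  obtain ⟨σ, rfl⟩ := σ.exists_rep
  simp only [← mk_app, ← mk_subst, ← QVal.mk_subst, Comp.subst]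

@[simp] theorem ret_subst (V : QVal Γ A) (σ : QSub Γ Δ) :
    (ret (S := S) V).subst σ = ret (V.subst σ) := by
  obtain ⟨V, rfl⟩ := V.exists_rep
  obtain ⟨σ, rfl⟩ := σ.exists_rep
  simp only [← mk_ret, ← mk_subst, ← QVal.mk_subst, Comp.subst]

@[simp] theorem letIn_subst (M : QComp Γ ⟨A, S⟩) (N : QComp (A :: Γ) ⟨B, S⟩) (σ : QSub Γ Δ) :
    (letIn M N).subst σ = letIn (M.subst σ) (N.subst σ.up) := by
  obtain ⟨M, rfl⟩ := M.exists_rep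
  obtain ⟨N, rfl⟩ := N.exists_rep
  obtain ⟨σ, rfl⟩ := σ.exists_rep
  simp only [← mk_letIn, ← mk_subst, ← QSub.mk_up, Comp.subst]

@[simp] theorem op_subst (o : {o // o ∈ S.dom}) (V : QVal Γ (S.arg o)) (σ : QSub Γ Δ) :
    (op o V).subst σ = op o (V.subst σ) := by
  obtain ⟨V, rfl⟩ := V.exists_rep
  obtain ⟨σ, rfl⟩ := σ.exists_rep
  simp only [← mk_op, ← mk_subst, ← QVal.mk_subst, Comp.subst]

@[simp] theorem handle_subst (M : QComp Γ ⟨A, S⟩) (H : QHandler Γ S C) (N : QComp (A :: Γ) C)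
    (σ : QSub Γ Δ) :
    (handle M H N).subst σ =
      handle (M.subst σ) (fun o => (H o).subst σ.up.up) (N.subst σ.up) := by
  obtain ⟨M, rfl⟩ := M.exists_rep
  obtain ⟨H, rfl⟩ := H.exists_rep
  obtain ⟨N, rfl⟩ := N.exists_rep
  obtain ⟨σ, rfl⟩ := σ.exists_rep
  simp only [← mk_handle, ← mk_subst, ← QSub.mk_up, Comp.subst, Handler.subst]

@[simp] theorem app_lam (M : QComp (A :: Γ) C) (V : QVal Γ A) :
    app (.lam M) V = M.subst (QSub.id.cons V) := by
  obtain ⟨M, rfl⟩ := M.exists_rep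
  obtain ⟨V, rfl⟩ := V.exists_rep
  rw [← QVal.mk_lam, ← mk_app, ← QSub.mk_id, ← QSub.mk_cons, ← mk_subst]
  exact mk_eq.2 (.abs_beta M V)

@[simp] theorem letIn_ret (V : QVal Γ A) (M : QComp (A :: Γ) ⟨B, S⟩) :
    letIn (ret V) M = M.subst (QSub.id.cons V) := by
  obtain ⟨M, rfl⟩ := M.exists_rep
  obtain ⟨V, rfl⟩ := V.exists_rep
  rw [← mk_ret, ← mk_letIn, ← QSub.mk_id, ← QSub.mk_cons, ← mk_subst]
  exact mk_eq.2 (.ret_let V M)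

@[simp] theorem letIn_ret_last (M : QComp Γ ⟨A, S⟩) : letIn M (ret .last) = M := by
  obtain ⟨M, rfl⟩ := M.exists_rep
  rw [QVal.last, QVal.var, ← mk_ret, ← mk_letIn]
  exact mk_eq.2 (.let_ret M)

theorem mk_rename_up_wk (M : Comp (A :: Γ) C) :
    mk (M.rename (Ren.up (Ren.wk (B := B)))) = (mk M).subst QSub.wk.up := by
  rw [Comp.rename_eq_subst, mk_subst, Ren.toSub_up, QSub.mk_up, QSub.mk_wk]

@[simp] theorem letIn_letIn {A₁ A₂ A₃ : Ty Op} (M : QComp Γ ⟨A₁, S⟩)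
    (N : QComp (A₁ :: Γ) ⟨A₂, S⟩) (L : QComp (A₂ :: Γ) ⟨A₃, S⟩) :
    letIn (letIn M N) L = letIn M (letIn N (L.subst QSub.wk.up)) := by
  obtain ⟨M, rfl⟩ := M.exists_rep
  obtain ⟨N, rfl⟩ := N.exists_rep
  obtain ⟨L, rfl⟩ := L.exists_rep
  simp only [← mk_letIn, ← mk_rename_up_wk]
  exact mk_eq.2 (.let_let M N L)

@[simp] theorem handle_ret (V : QVal Γ A) (H : QHandler Γ S C) (M : QComp (A :: Γ) C) :
    handle (ret V) H M = M.subst (QSub.id.cons V) := by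
  obtain ⟨M, rfl⟩ := M.exists_rep
  obtain ⟨V, rfl⟩ := V.exists_rep
  obtain ⟨H, rfl⟩ := H.exists_rep
  rw [← mk_ret, ← mk_handle, ← QSub.mk_id, ← QSub.mk_cons, ← mk_subst]
  exact mk_eq.2 (.handle_ret V _ M)

@[simp] theorem handle_letIn (H : QHandler Γ S C) (L : QComp Γ ⟨A, S⟩)
    (M : QComp (A :: Γ) ⟨B, S⟩) (N : QComp (B :: Γ) C) :
    handle (letIn L M) H N =
      handle L H (handle M (fun o => (H o).subst QSub.wk.up.up) (N.subst QSub.wk.up)) := by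
  obtain ⟨L, rfl⟩ := L.exists_rep
  obtain ⟨M, rfl⟩ := M.exists_rep
  obtain ⟨N, rfl⟩ := N.exists_rep
  obtain ⟨H, rfl⟩ := H.exists_rep
  have handle_let := mk_eq.2 (CompEq.handle_let (.mk H) L M N)
  rw [Handler.rename_eq_subst, Handler.subst] at handle_let
  simpa only [mk_letIn, mk_handle, mk_rename_up_wk, mk_subst, QSub.mk_up, QSub.mk_wk]
    using handle_let

@[simp] theorem handle_op (o : {o // o ∈ S.dom}) (H : QHandler Γ S C)
    (M : QComp (S.res o :: Γ) C) (V : QVal Γ (S.arg o)) :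
    handle (op o V) H M = (H o).subst ((QSub.id.cons V).cons (.lam M)) := by
  obtain ⟨M, rfl⟩ := M.exists_rep
  obtain ⟨V, rfl⟩ := V.exists_rep
  obtain ⟨H, rfl⟩ := H.exists_rep
  rw [← mk_op, ← mk_handle, ← QVal.mk_lam, ← QSub.mk_id, ← QSub.mk_cons, ← QSub.mk_cons,
    ← mk_subst]
  exact mk_eq.2 (.handle_op o H M V)

end QComp

end Quotient

/-! ### Thunks -/

/-- The empty product, which is the unit type. -/
abbrev Ty.unit : Ty Op := .prod (Fin.elim0 : Fin 0 → Ty Op)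

/-- The type of thunks of computations of type `A ! S`, that is, of functions out of the unit
type. -/
def Ty.thunk (S : Sig Op) (A : Ty Op) : Ty Op := .fn .unit ⟨A, S⟩

section Thunk

variable {Γ Δ : Ctx Op} {A : Ty Op} {S : Sig Op}

/-- The element of the unit type. -/
noncomputable def QVal.unit : QVal Γ .unit := tuple fun i => i.elim0

theorem QVal.eq_unit (V W : QVal Γ .unit) : V = W := prod_ext fun i => i.elim0

/-- Suspension of a computation. -/
noncomputable def QVal.thunk (M : QComp Γ ⟨A, S⟩) : QVal Γ (.thunk S A) := lam (M.subst .wk)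

/-- Running a suspended computation. -/
noncomputable def QComp.force (V : QVal Γ (.thunk S A)) : QComp Γ ⟨A, S⟩ := app (A := .unit) V .unit

@[simp] theorem QVal.thunk_subst (M : QComp Γ ⟨A, S⟩) (σ : QSub Γ Δ) :
    (thunk M).subst σ = thunk (M.subst σ) :=
  (lam_subst _ _).trans (by simp [thunk])

@[simp] theorem QComp.force_subst (V : QVal Γ (.thunk S A)) (σ : QSub Γ Δ) :
    (force V).subst σ = force (V.subst σ) :=
  (app_subst (A := .unit) V .unit σ).trans (congrArg (app _) (QVal.eq_unit _ _))

@[simp] theorem QComp.force_thunk (M : QComp Γ ⟨A, S⟩) : force (.thunk M) = M :=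
  (app_lam _ _).trans (by simp)

@[simp] theorem QVal.thunk_force (V : QVal Γ (.thunk S A)) : thunk (.force V) = V := by
  refine Eq.trans ?_ (lam_app (A := .unit) V)
  rw [thunk, QComp.force_subst, ← eq_unit unit last]
  rfl

end Thunk

/-! ### The category of types and terms -/

namespace TermModel

noncomputable instance category : Category.{u} (Ty Op) where
  Hom A B := QVal [A] B
  id A := .last
  comp f g := g.subst (QSub.nil.cons f)
  id_comp f := by simp
  comp_id f := by simp
  assoc f g h := by simp

section Category

variable {A B C : Ty Op}

/-- A term in a context of length one, as a morphism. -/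
def hom (V : QVal [A] B) : A ⟶ B := V

/-- A morphism, as a term in a context of length one. -/
def term (f : A ⟶ B) : QVal [A] B := f

@[simp] theorem term_hom (V : QVal [A] B) : term (hom V) = V := rfl

theorem term_injective {f g : A ⟶ B} (h : term f = term g) : f = g := h

@[simp] theorem term_id : term (𝟙 A) = .last := rfl

@[simp] theorem term_comp (f : A ⟶ B) (g : B ⟶ C) :
    term (f ≫ g) = (term g).subst (QSub.nil.cons (term f)) := rfl

end Category

noncomputable instance cartesianCat : CartesianCat (Ty Op) where
  pi A := .prod A
  π A i := hom (.proj i .last)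
  tuple f := hom (.tuple fun i => term (f i))
  tuple_π f i := term_injective (by simp)
  hom_ext f g h := term_injective <| QVal.prod_ext fun i => by
    simpa using congrArg term (h i)

end TermModel

namespace QVal

variable {Γ Δ : Ctx Op} {A B : Ty Op}

/-- Pairing. -/
noncomputable def pair (V : QVal Γ A) (W : QVal Γ B) : QVal Γ (A ⊗ B) :=
  tuple (Fin.cons (α := fun i => QVal Γ (![A, B] i)) V
    (Fin.cons (α := fun i : Fin 1 => QVal Γ (![B] i)) W fun i => i.elim0))

/-- The first projection. -/
noncomputable def fst (V : QVal Γ (A ⊗ B)) : QVal Γ A := proj (F := ![A, B]) 0 V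

/-- The second projection. -/
noncomputable def snd (V : QVal Γ (A ⊗ B)) : QVal Γ B := proj (F := ![A, B]) 1 V

@[simp] theorem fst_pair (V : QVal Γ A) (W : QVal Γ B) : fst (pair V W) = V :=
  proj_tuple (F := ![A, B]) 0 _

@[simp] theorem snd_pair (V : QVal Γ A) (W : QVal Γ B) : snd (pair V W) = W :=
  proj_tuple (F := ![A, B]) 1 _

theorem pair_ext {V W : QVal Γ (A ⊗ B)} (h : fst V = fst W) (h' : snd V = snd W) : V = W :=
  prod_ext (F := ![A, B]) fun i => by
    fin_cases i
    exacts [h, h']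

@[simp] theorem pair_fst_snd (V : QVal Γ (A ⊗ B)) : pair (fst V) (snd V) = V :=
  pair_ext (fst_pair _ _) (snd_pair _ _)

@[simp] theorem fst_subst (V : QVal Γ (A ⊗ B)) (σ : QSub Γ Δ) :
    (fst V).subst σ = fst (V.subst σ) := proj_subst (F := ![A, B]) 0 V σ

@[simp] theorem snd_subst (V : QVal Γ (A ⊗ B)) (σ : QSub Γ Δ) :
    (snd V).subst σ = snd (V.subst σ) := proj_subst (F := ![A, B]) 1 V σ

@[simp] theorem pair_subst (V : QVal Γ A) (W : QVal Γ B) (σ : QSub Γ Δ) :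
    (pair V W).subst σ = pair (V.subst σ) (W.subst σ) :=
  pair_ext (by rw [← fst_subst, fst_pair, fst_pair]) (by rw [← snd_subst, snd_pair, snd_pair])

end QVal

namespace TermModel

section Cartesian

variable {X X' Y Y' Z : Ty Op}

@[simp] theorem term_fst : term (fst X Y) = .fst .last := rfl

@[simp] theorem term_snd : term (snd X Y) = .snd .last := rfl

@[simp] theorem term_lift (f : Z ⟶ X) (g : Z ⟶ Y) :
    term (lift f g) = .pair (term f) (term g) :=
  QVal.pair_ext (by simpa [-lift_fst] using congrArg term (lift_fst f g))
    (by simpa [-lift_snd] using congrArg term (lift_snd f g))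

@[simp] theorem term_tensorHom (f : X ⟶ X') (g : Y ⟶ Y') :
    term (f ⊗ₘ g) = .pair ((term f).subst (QSub.nil.cons (.fst .last)))
      ((term g).subst (QSub.nil.cons (.snd .last))) := by
  rw [← lift_fst_comp_snd_comp]
  simp [-lift_fst_comp_snd_comp]

@[simp] theorem term_whiskerLeft (g : Y ⟶ Y') :
    term (X ◁ g) = .pair (.fst .last) ((term g).subst (QSub.nil.cons (.snd .last))) := by
  rw [← id_tensorHom]
  simp [-id_tensorHom]

@[simp] theorem term_whiskerRight (f : X ⟶ X') :
    term (f ▷ Y) = .pair ((term f).subst (QSub.nil.cons (.fst .last))) (.snd .last) := by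
  rw [← tensorHom_id]
  simp [-tensorHom_id]

@[simp] theorem term_leftUnitor_hom : term (λ_ X).hom = .snd .last := by
  rw [leftUnitor_hom, term_snd]

@[simp] theorem term_associator_hom :
    term (α_ X Y Z).hom = .pair (.fst (.fst .last)) (.pair (.snd (.fst .last)) (.snd .last)) := by
  have hom_eq : (α_ X Y Z).hom = lift (fst _ _ ≫ fst _ _) (lift (fst _ _ ≫ snd _ _) (snd _ _)) := by
    ext <;> simp
  simp [hom_eq]

@[simp] theorem term_associator_inv :
    term (α_ X Y Z).inv = .pair (.pair (.fst .last) (.fst (.snd .last))) (.snd (.snd .last)) := by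
  have inv_eq : (α_ X Y Z).inv = lift (lift (fst _ _) (snd _ _ ≫ fst _ _)) (snd _ _ ≫ snd _ _) := by
    ext <;> simp
  simp [inv_eq]

end Cartesian

/-! ### The monads of thunks -/

section Monad

variable (S : Sig Op) {A B : Ty Op}

/-- The functor of thunks. -/
noncomputable abbrev functor : Ty Op ⥤ Ty Op where
  obj A := .thunk S A
  map f := hom (.thunk (.letIn (.force .last) (.ret ((term f).subst (QSub.nil.cons .last)))))
  map_id A := term_injective (by simp)
  map_comp f g := term_injective (by simp)

@[simp] theorem term_functor_map (f : A ⟶ B) : term ((functor S).map f) =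
    .thunk (.letIn (.force .last) (.ret ((term f).subst (QSub.nil.cons .last)))) := rfl

/-- The unit of the monad of thunks. -/
noncomputable def unit : 𝟭 (Ty Op) ⟶ functor S where
  app A := hom (.thunk (.ret .last))
  naturality A B f := term_injective (by simp)

@[simp] theorem term_unit_app : term ((unit S).app A) = .thunk (.ret .last) := rfl

/-- The multiplication of the monad of thunks. -/
noncomputable def mult : functor S ⋙ functor S ⟶ functor S where
  app A := hom (.thunk (.letIn (.force .last) (.force .last)))
  naturality A B f := term_injective (by simp)

@[simp] theorem term_mult_app :
    term ((mult S).app A) = .thunk (.letIn (.force .last) (.force .last)) := rfl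

/-- The monad of thunks. -/
noncomputable abbrev monad : Monad (Ty Op) where
  toFunctor := functor S
  η := unit S
  μ := mult S
  left_unit A := term_injective (by simp)
  right_unit A := term_injective (by simp)
  assoc A := term_injective (by simp)

/-- The strength of the monad of thunks. -/
noncomputable def strength (X Y : Ty Op) : X ⊗ .thunk S Y ⟶ .thunk S (X ⊗ Y) :=
  hom (.thunk (.letIn (.force (.snd .last)) (.ret (.pair (.fst (.subst .last .wk)) .last))))

@[simp] theorem term_strength (X Y : Ty Op) : term (strength S X Y) =
    .thunk (.letIn (.force (.snd .last)) (.ret (.pair (.fst (.subst .last .wk)) .last))) := rfl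

/-- The strong monad of thunks. -/
noncomputable abbrev strongMonad : StrongMonad (Ty Op) where
  T := monad S
  st := strength S
  st_natural f g := term_injective (by simp)
  st_leftUnitor X := term_injective (by simp)
  st_associator X Y Z := term_injective (by simp)
  st_unit X Y := term_injective (by simp)
  st_mult X Y := term_injective (by simp)

/-- Currying of terms. -/
noncomputable def curryEquiv (X Y Z : Ty Op) :
    (X ⊗ Y ⟶ Ty.thunk S Z) ≃ (X ⟶ Ty.fn Y ⟨Z, S⟩) where
  toFun f := hom (.lam (.force ((term f).subst (QSub.nil.cons (.pair (.subst .last .wk) .last)))))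
  invFun g := hom (.thunk (.app ((term g).subst (QSub.nil.cons (.fst .last))) (.snd .last)))
  left_inv f := term_injective (by simp)
  right_inv g := term_injective (by simp [QVal.lam_app])

@[simp] theorem term_curryEquiv {X Y Z : Ty Op} (f : X ⊗ Y ⟶ Ty.thunk S Z) :
    term (curryEquiv S X Y Z f) =
      .lam (.force ((term f).subst (QSub.nil.cons (.pair (.subst .last .wk) .last)))) := rfl

/-- Function types as Kleisli exponentials. -/
noncomputable abbrev kleisliExp (Y Z : Ty Op) : KleisliExp (strongMonad S).T Y Z where
  obj := .fn Y ⟨Z, S⟩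
  curry {X} := curryEquiv S X Y Z
  curry_natural f g := term_injective (by simp)

@[simp] theorem term_kleisliExp_eval (Y Z : Ty Op) :
    term (kleisliExp S Y Z).eval = .thunk (.app (.fst .last) (.snd .last)) :=
  congrArg (fun V : QVal [Ty.fn Y ⟨Z, S⟩ ⊗ Y] (Ty.fn Y ⟨Z, S⟩) =>
    QVal.thunk (.app V (.snd .last))) (QVal.last_subst_cons _ _)

end Monad

/-! ### Operations and handlers -/

section Handling

variable {S S' : Sig Op} {X : Ty Op} {Γ Δ : Ctx Op}

/-- The operations, as morphisms. -/
noncomputable def operation (o : {o // o ∈ S.dom}) : S.arg o ⟶ Ty.thunk S (S.res o) :=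
  hom (.thunk (.op o .last))

@[simp] theorem term_operation (o : {o // o ∈ S.dom}) :
    term (operation o) = .thunk (.op o .last) := rfl

/-- The clause for `o` of a tuple of clauses. -/
noncomputable def component (o : {o // o ∈ S.dom}) (V : QVal Γ (HBundle (kleisliExp S') S X)) :
    QVal Γ (Ty.fn (S.arg o ⊗ Ty.fn (S.res o) ⟨X, S'⟩) ⟨X, S'⟩) :=
  (term (πFinite (clauseObj (kleisliExp S') S X) o)).subst (QSub.nil.cons V)

@[simp] theorem component_subst (o : {o // o ∈ S.dom})
    (V : QVal Γ (HBundle (kleisliExp S') S X)) (σ : QSub Γ Δ) :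
    (component o V).subst σ = component o (V.subst σ) := by
  simp [component]

theorem term_πFinite (o : {o // o ∈ S.dom}) :
    term (πFinite (clauseObj (kleisliExp S') S X) o) = component o .last := by
  simp [component]

variable (S S' X) in
/-- The handling morphisms, which run a suspended computation and pass the argument of an operation
and its continuation, as a pair, to the clause for that operation. -/
noncomputable def handling :
    HBundle (kleisliExp S') S X ⊗ .thunk S (.thunk S' X) ⟶ .thunk S' X :=
  hom (.thunk (.handle (.force (.snd .last))
    (fun o => .app (component o (.fst (.subst .last (QSub.wk.comp .wk))))
      (.pair (.subst .last .wk) .last))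
    (.force .last)))

@[simp] theorem term_handling : term (handling S S' X) =
    .thunk (.handle (.force (.snd .last))
      (fun o => .app (component o (.fst (.subst .last (QSub.wk.comp .wk))))
        (.pair (.subst .last .wk) .last))
      (.force .last)) := rfl

theorem handling_unit :
    (HBundle (kleisliExp S') S X ◁ (monad S).η.app (.thunk S' X)) ≫ handling S S' X = snd _ _ :=
  term_injective (by simp)

theorem handling_mult :
    (HBundle (kleisliExp S') S X ◁ (monad S).μ.app (.thunk S' X)) ≫ handling S S' X =
      lift (fst _ _) (strength S _ _) ≫
        (HBundle (kleisliExp S') S X ◁ (monad S).map (handling S S' X)) ≫ handling S S' X :=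
  term_injective (by simp)

theorem handling_operation (o : {o // o ∈ S.dom}) :
    (HBundle (kleisliExp S') S X ◁
        mixedOp (T := strongMonad S) (kleisliExp S') (operation o) X) ≫ handling S S' X =
      (πFinite (clauseObj (kleisliExp S') S X) o ▷
        (S.arg o ⊗ (kleisliExp S' (S.res o) X).obj)) ≫ (kleisliExp S' _ X).eval :=
  term_injective (by
    have continuation_eta := QVal.lam_app (.snd (.snd (.last :
      QVal [HBundle (kleisliExp S') S X ⊗ (S.arg o ⊗ Ty.fn (S.res o) ⟨X, S'⟩)] _)))
    simp only [QVal.snd_subst] at continuation_eta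
    simp [mixedOp, term_πFinite, continuation_eta])

end Handling

end TermModel

/-- The term model. -/
noncomputable abbrev termModel (Op : Type u) : Model Op where
  C := Ty Op
  T := TermModel.strongMonad
  exp := TermModel.kleisliExp
  op _ := TermModel.operation
  handle := TermModel.handling
  handle_unit _ _ _ := TermModel.handling_unit
  handle_mult _ _ _ := TermModel.handling_mult
  handle_op _ _ _ := TermModel.handling_operation

/-! ### Transport along equalities of types -/

section Cast

variable {Γ Δ : Ctx Op} {A A' B B' : Ty Op} {n : ℕ} {F F' : Fin n → Ty Op} {C C' : CTy Op}
  {S S' : Sig Op}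

/-- Transport of value terms along an equality of types. -/
def QVal.cast (h : A = A') (V : QVal Γ A) : QVal Γ A' := h ▸ V

/-- Transport of computation terms along an equality of types. -/
def QComp.cast (h : C = C') (M : QComp Γ C) : QComp Γ C' := h ▸ M

/-- The change of the type of the last variable along an equality. -/
def QSub.castLast (h : A = A') : QSub (A :: Γ) (A' :: Γ) := wk.cons (QVal.last.cast h.symm)

@[simp] theorem QVal.cast_rfl (V : QVal Γ A) : V.cast rfl = V := rfl

@[simp] theorem QComp.cast_rfl (M : QComp Γ C) : M.cast rfl = M := rfl

@[simp] theorem QSub.castLast_rfl : castLast (Γ := Γ) (rfl : A = A) = id := cons_wk_last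

theorem QVal.cast_injective (h : A = A') : Function.Injective (cast (Γ := Γ) h) := by
  subst h
  exact Function.injective_id

theorem QComp.cast_injective (h : C = C') : Function.Injective (cast (Γ := Γ) h) := by
  subst h
  exact Function.injective_id

@[simp] theorem QVal.cast_cast_symm (h : A = A') (V : QVal Γ A') : (V.cast h.symm).cast h = V := by
  subst h
  rfl

@[simp] theorem QVal.cast_subst (h : A = A') (V : QVal Γ A) (σ : QSub Γ Δ) :
    (V.cast h).subst σ = (V.subst σ).cast h := by
  subst h
  rfl

@[simp] theorem QComp.cast_subst (h : C = C') (M : QComp Γ C) (σ : QSub Γ Δ) :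
    (M.cast h).subst σ = (M.subst σ).cast h := by
  subst h
  rfl

theorem QVal.lam_cast (hA : A = A') (hC : C = C') (M : QComp (A :: Γ) C) :
    (lam M).cast (congrArg₂ Ty.fn hA hC) = lam ((M.subst (.castLast hA)).cast hC) := by
  subst hA hC
  simp

theorem QVal.tuple_cast (h : ∀ i, F i = F' i) (V : ∀ i, QVal Γ (F i)) :
    (tuple V).cast (congrArg Ty.prod (funext h)) = tuple fun i => (V i).cast (h i) := by
  obtain rfl := funext h
  rfl

theorem QVal.proj_cast (h : ∀ i, F i = F' i) (i : Fin n) (V : QVal Γ (Ty.prod F)) :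
    (proj i V).cast (h i) = proj i (V.cast (congrArg Ty.prod (funext h))) := by
  obtain rfl := funext h
  rfl

theorem QComp.app_cast (hA : A = A') (hC : C = C') (V : QVal Γ (Ty.fn A C)) (W : QVal Γ A) :
    (app V W).cast hC = app (V.cast (congrArg₂ Ty.fn hA hC)) (W.cast hA) := by
  subst hA hC
  rfl

theorem QComp.ret_cast (hA : A = A') (hS : S = S') (V : QVal Γ A) :
    (ret V).cast (congrArg₂ CTy.mk hA hS) = ret (V.cast hA) := by
  subst hA hS
  rfl

theorem QComp.letIn_cast (hA : A = A') (hB : B = B') (hS : S = S') (M : QComp Γ ⟨A, S⟩)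
    (N : QComp (A :: Γ) ⟨B, S⟩) :
    (letIn M N).cast (congrArg₂ CTy.mk hB hS) = letIn (M.cast (congrArg₂ CTy.mk hA hS))
      ((N.subst (.castLast hA)).cast (congrArg₂ CTy.mk hB hS)) := by
  subst hA hB hS
  simp

theorem QComp.op_cast {dom : Finset Op} {arg arg' res res' : {o // o ∈ dom} → Ty Op}
    (harg : arg = arg') (hres : res = res') (o : {o // o ∈ dom}) (V : QVal Γ (arg o)) :
    (op (S := ⟨dom, arg, res⟩) o V).cast (by rw [harg, hres]) =
      op (S := ⟨dom, arg', res'⟩) o (V.cast (congrFun harg o)) := by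
  subst harg hres
  rfl

theorem QComp.handle_cast {dom : Finset Op} {arg arg' res res' : {o // o ∈ dom} → Ty Op}
    (harg : arg = arg') (hres : res = res') (hA : A = A') (hC : C = C')
    (M : QComp Γ ⟨A, dom, arg, res⟩) (H : QHandler Γ ⟨dom, arg, res⟩ C) (N : QComp (A :: Γ) C) :
    (handle M H N).cast hC = handle (S := ⟨dom, arg', res'⟩) (M.cast (by rw [harg, hres, hA]))
      (fun o => (((H o).subst (QSub.castLast (congrFun harg o)).up).subst
        (.castLast (congrArg₂ Ty.fn (congrFun hres o) hC))).cast hC)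
      ((N.subst (.castLast hA)).cast hC) := by
  subst harg hres hA hC
  simp

end Cast

namespace Model

variable (𝓜 : Model Op) {Γ : Ctx Op} {S : Sig Op} {C : CTy Op}

theorem handler_πFinite (M : ∀ o : {o // o ∈ S.dom}, Comp (Ty.fn (S.res o) C :: S.arg o :: Γ) C)
    (o : {o // o ∈ S.dom}) :
    𝓜.handler (.mk M) ≫ πFinite (clauseObj (𝓜.exp (𝓜.sig C.sig)) (𝓜.sig S) (𝓜.ty C.val)) o =
      (𝓜.exp (𝓜.sig C.sig) (𝓜.ty (S.arg o) ⊗ (𝓜.fnExp (S.res o) C).obj) (𝓜.ty C.val)).curry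
        ((α_ (𝓜.ctx Γ) (𝓜.ty (S.arg o)) (𝓜.fnExp (S.res o) C).obj).inv ≫ 𝓜.comp (M o)) := by
  rw [handler]
  exact tupleFinite_πFinite _ o

variable {𝓜} in
theorem comp_eq_of_handler_eq
    {M N : ∀ o : {o // o ∈ S.dom}, Comp (Ty.fn (S.res o) C :: S.arg o :: Γ) C}
    (h : 𝓜.handler (.mk M) = 𝓜.handler (.mk N)) (o : {o // o ∈ S.dom}) :
    𝓜.comp (M o) = 𝓜.comp (N o) := by
  have curry_eq := (𝓜.handler_πFinite M o).symm
  rw [h, handler_πFinite] at curry_eq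
  exact (cancel_epi _).1 (Equiv.injective _ curry_eq)

end Model

/-! ### The interpretation in the term model -/

namespace TermModel

/-- The interpretation of value types. -/
noncomputable abbrev ty (A : Ty Op) : Ty Op := (termModel Op).ty A

/-- The interpretation of signatures. -/
noncomputable abbrev sig (S : Sig Op) : Sig Op :=
  ⟨S.dom, fun o => ty (S.arg o), fun o => ty (S.res o)⟩

/-- The interpretation of computation types, before suspension. -/
noncomputable abbrev cty (C : CTy Op) : CTy Op := ⟨ty C.val, sig C.sig⟩

/-- The interpretation of contexts. -/
noncomputable abbrev ctx (Γ : Ctx Op) : Ty Op := (termModel Op).ctx Γ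

theorem ty_eq : ∀ A : Ty Op, ty A = A
  | .prod A => congrArg Ty.prod (funext fun i => ty_eq (A i))
  | .arr A B dom arg res => by
      change Ty.arr (ty A) (ty B) dom (fun o => ty (arg o)) (fun o => ty (res o)) = _
      rw [ty_eq A, ty_eq B, funext fun o => ty_eq (arg o), funext fun o => ty_eq (res o)]

theorem sig_eq (S : Sig Op) : sig S = S := by
  simp only [sig, ty_eq]

theorem cty_eq (C : CTy Op) : cty C = C := by
  simp only [cty, ty_eq, sig_eq]

section Interpretation

variable {Γ Δ : Ctx Op} {A B : Ty Op} {n : ℕ} {F : Fin n → Ty Op} {S : Sig Op} {C : CTy Op}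

/-- The interpretation of value terms. -/
noncomputable def val (V : Val Γ A) : ctx Γ ⟶ ty A := (termModel Op).val V

/-- The interpretation of computation terms. -/
noncomputable def comp (M : Comp Γ C) : ctx Γ ⟶ Ty.thunk (sig C.sig) (ty C.val) :=
  (termModel Op).comp M

/-- The interpretation of handlers. -/
noncomputable def handler (H : Handler Γ S C) :
    ctx Γ ⟶ HBundle (kleisliExp (sig C.sig)) (sig S) (ty C.val) :=
  (termModel Op).handler H

/-- The tuple of the variables of a context. -/
noncomputable def vars : (Γ : Ctx Op) → QVal Γ (ctx Γ)
  | [] => .unit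
  | A :: Γ => .pair (A := ctx Γ) (B := ty A) ((vars Γ).subst .wk) (QVal.last.cast (ty_eq A).symm)

/-- The interpretation of a value term, at the tuple of the variables of its context. -/
noncomputable def openVal (V : Val Γ A) : QVal Γ (ty A) :=
  (term (val V)).subst (QSub.nil.cons (vars Γ))

/-- The interpretation of a computation term, at the tuple of the variables of its context. -/
noncomputable def openComp (M : Comp Γ C) : QComp Γ (cty C) :=
  .force ((term (comp M)).subst (QSub.nil.cons (vars Γ)))

theorem openComp_subst_castLast (M : Comp (A :: Γ) C) :
    (openComp M).subst (.castLast (ty_eq A).symm) = .force ((term (comp M)).subst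
      (QSub.nil.cons (.pair (A := ctx Γ) (B := ty A) ((vars Γ).subst .wk) .last))) := by
  simp [openComp, vars, QSub.castLast]

theorem openVal_lam (M : Comp (A :: Γ) C) :
    openVal (.lam M) =
      .lam (C := cty C) ((openComp M).subst (.castLast (ty_eq A).symm)) := by
  rw [openComp_subst_castLast]
  change (term (curryEquiv (sig C.sig) (ctx Γ) (ty A) (ty C.val) (comp M))).subst _ = _
  simp [ctx]

theorem openVal_tuple (V : ∀ i, Val Γ (F i)) :
    openVal (.tuple V) = .tuple (F := fun i => ty (F i)) fun i => openVal (V i) :=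
  QVal.tuple_subst _ _

theorem openVal_proj (i : Fin n) (V : Val Γ (Ty.prod F)) :
    openVal (.proj i V) = .proj (F := fun i => ty (F i)) i (openVal V) := by
  change (QVal.subst (.proj (F := fun i => ty (F i)) i .last)
    (QSub.nil.cons (term (val V)))).subst _ = _
  simp [openVal]

theorem openComp_ret (V : Val Γ A) : openComp (.ret (S := S) V) = .ret (openVal V) := by
  change QComp.force ((term (val V ≫ (monad (sig S)).η.app (ty A))).subst _) = _
  simp [openVal]

theorem openComp_op (o : {o // o ∈ S.dom}) (V : Val Γ (S.arg o)) :
    openComp (.op o V) = .op (S := sig S) o (openVal V) := by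
  change QComp.force ((term (val V ≫ operation (S := sig S) o)).subst _) = _
  simp [openVal]

theorem openComp_letIn (M : Comp Γ ⟨A, S⟩) (N : Comp (A :: Γ) ⟨B, S⟩) :
    openComp (.letIn M N) =
      .letIn (A := ty A) (B := ty B) (S := sig S) (openComp M)
        ((openComp N).subst (.castLast (ty_eq A).symm)) := by
  rw [openComp_subst_castLast]
  change QComp.force ((term (lift (𝟙 (ctx Γ)) (comp M) ≫ strength (sig S) (ctx Γ) (ty A) ≫
    (monad (sig S)).map (comp N : ctx Γ ⊗ ty A ⟶ _) ≫ (monad (sig S)).μ.app _)).subst _) = _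
  simp [openComp]

theorem openComp_app (V : Val Γ (Ty.fn A C)) (W : Val Γ A) :
    openComp (.app V W) = .app (A := ty A) (C := cty C) (openVal V) (openVal W) := by
  have term_lift_eval {X Y Z : Ty Op} {S : Sig Op} (f : X ⟶ Ty.fn Y ⟨Z, S⟩) (g : X ⟶ Y) :
      term (lift f g ≫ (kleisliExp S Y Z).eval) = .thunk (.app (term f) (term g)) := by
    simp
  have term_comp_app : term (comp (.app V W)) =
    .thunk (.app (A := ty A) (C := cty C) (term (val V)) (term (val W))) :=
    term_lift_eval _ _
  simp [openComp, openVal, term_comp_app]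

theorem component_handler (M : ∀ o : {o // o ∈ S.dom}, Comp (Ty.fn (S.res o) C :: S.arg o :: Γ) C)
    (o : {o // o ∈ S.dom}) (σ : QSub [ctx Γ] Δ) :
    component (S := sig S) o ((term (handler (.mk M))).subst σ) =
      .lam (C := cty C) (.force ((term (comp (M o))).subst (QSub.nil.cons
        (.pair (A := ctx Γ ⊗ ty (S.arg o)) (B := Ty.fn (ty (S.res o)) (cty C))
          (.pair (QVal.last.subst (σ.comp .wk)) (.fst .last)) (.snd .last))))) := by
  have component_eq : component (S := sig S) o (term (handler (.mk M))) =
      term (curryEquiv (sig C.sig) (ctx Γ) _ (ty C.val) ((α_ (ctx Γ) (ty (S.arg o)) _).inv ≫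
        comp (M o))) :=
    congrArg term ((termModel Op).handler_πFinite M o)
  rw [← component_subst, component_eq]
  simp

theorem openComp_subst_castLast₂ (M : Comp (B :: A :: Γ) C) :
    ((openComp M).subst (QSub.castLast (ty_eq A).symm).up).subst (.castLast (ty_eq B).symm) =
      .force ((term (comp M)).subst (QSub.nil.cons (.pair (A := ctx Γ ⊗ ty A) (B := ty B)
        (.pair ((vars Γ).subst (QSub.wk.comp .wk)) (.subst .last .wk)) .last))) := by
  simp [openComp, vars, QSub.castLast]

theorem openComp_handle (M : Comp Γ ⟨A, S⟩)
    (H : ∀ o : {o // o ∈ S.dom}, Comp (Ty.fn (S.res o) C :: S.arg o :: Γ) C)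
    (N : Comp (A :: Γ) C) :
    openComp (.handle M (.mk H) N) =
      .handle (A := ty A) (S := sig S) (C := cty C) (openComp M)
        (fun o => ((openComp (H o)).subst (QSub.castLast (ty_eq (S.arg o)).symm).up).subst
          (.castLast (ty_eq (Ty.fn (S.res o) C)).symm))
        ((openComp N).subst (.castLast (ty_eq A).symm)) := by
  simp only [openComp_subst_castLast, openComp_subst_castLast₂]
  change QComp.force ((term (lift (handler (.mk H)) (lift (𝟙 (ctx Γ)) (comp M) ≫
    strength (sig S) (ctx Γ) (ty A) ≫ (monad (sig S)).map (comp N : ctx Γ ⊗ ty A ⟶ _)) ≫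
      handling (sig S) (sig C.sig) (ty C.val))).subst _) = _
  simp [openComp, component_handler]

end Interpretation

theorem openVal_var : ∀ {Γ : Ctx Op} {A : Ty Op} (x : Var Γ A),
    openVal (.var x) = (QVal.var x).cast (ty_eq A).symm
  | A :: Γ, _, .zero => by
      change (QVal.snd (A := ctx Γ) (B := ty A) .last).subst _ = _
      simp only [vars, QVal.snd_subst, QVal.last_subst_cons, QVal.snd_pair]
      rfl
  | B :: Γ, A, .succ x => by
      have openVal_succ : openVal (.var (.succ (B := B) x)) = (openVal (.var x)).subst .wk := by
        change (QVal.subst (term (val (.var x)))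
          (QSub.nil.cons (.fst (A := ctx Γ) (B := ty B) .last))).subst _ = _
        simp [vars, openVal]
      rw [openVal_succ, openVal_var x, QVal.cast_subst, QVal.var_subst]
      rfl

mutual

theorem openVal_eq : ∀ {Γ : Ctx Op} {A : Ty Op} (V : Val Γ A),
    openVal V = (QVal.mk V).cast (ty_eq A).symm
  | _, _, .var x => openVal_var x
  | _, _, .lam M => by
      rw [openVal_lam, openComp_eq M, QVal.mk_lam, QVal.lam_cast (ty_eq _).symm (cty_eq _).symm,
        QComp.cast_subst]
  | _, _, .tuple V => by
      rw [openVal_tuple, funext fun i => openVal_eq (V i), QVal.mk_tuple,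
        QVal.tuple_cast fun i => (ty_eq _).symm]
  | _, _, .proj (A := _) i V => by
      rw [openVal_proj, openVal_eq V, QVal.mk_proj, QVal.proj_cast fun i => (ty_eq _).symm]

theorem openComp_eq : ∀ {Γ : Ctx Op} {C : CTy Op} (M : Comp Γ C),
    openComp M = (QComp.mk M).cast (cty_eq C).symm
  | _, _, .app V W => by
      rw [openComp_app, openVal_eq V, openVal_eq W, QComp.mk_app,
        QComp.app_cast (ty_eq _).symm (cty_eq _).symm]
  | _, _, .ret V => by
      rw [openComp_ret, openVal_eq V, QComp.mk_ret,
        QComp.ret_cast (ty_eq _).symm (sig_eq _).symm]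
  | _, _, .letIn M N => by
      rw [openComp_letIn, openComp_eq M, openComp_eq N, QComp.mk_letIn,
        QComp.letIn_cast (ty_eq _).symm (ty_eq _).symm (sig_eq _).symm, QComp.cast_subst]
  | _, _, .op o V => by
      rw [openComp_op, openVal_eq V, QComp.mk_op,
        QComp.op_cast (funext fun o => (ty_eq _).symm) (funext fun o => (ty_eq _).symm)]
  | _, _, .handle M (.mk H) N => by
      rw [openComp_handle, openComp_eq M, openComp_eq N, QComp.mk_handle,
        QComp.handle_cast (funext fun o => (ty_eq _).symm) (funext fun o => (ty_eq _).symm)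
          (ty_eq _).symm (cty_eq _).symm]
      simp only [openComp_eq (H _), QComp.cast_subst]

end

theorem valEq_of_val_eq {Γ : Ctx Op} {A : Ty Op} {V W : Val Γ A}
    (h : (termModel Op).val V = (termModel Op).val W) : ValEq V W := by
  have openVal_congr : openVal V = openVal W := congrArg (fun f => (term f).subst _) h
  rw [openVal_eq, openVal_eq] at openVal_congr
  exact QVal.mk_eq.1 (QVal.cast_injective _ openVal_congr)

theorem compEq_of_comp_eq {Γ : Ctx Op} {C : CTy Op} {M N : Comp Γ C}
    (h : (termModel Op).comp M = (termModel Op).comp N) : CompEq M N := by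
  have openComp_congr : openComp M = openComp N :=
    congrArg (fun f => QComp.force ((term f).subst _)) h
  rw [openComp_eq, openComp_eq] at openComp_congr
  exact QComp.mk_eq.1 (QComp.cast_injective _ openComp_congr)

theorem handlerEq_of_handler_eq {Γ : Ctx Op} {S : Sig Op} {C : CTy Op} :
    ∀ {H H' : Handler Γ S C}, (termModel Op).handler H = (termModel Op).handler H' →
      HandlerEq H H'
  | .mk _, .mk _, h => .congr fun o => compEq_of_comp_eq (Model.comp_eq_of_handler_eq h o)

end TermModel

end EffCalc

theorem mainTheorem1_general {Op : Type*} (Γ : EffCalc.Ctx Op) :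
    (∀ (A : EffCalc.Ty Op) (V W : EffCalc.Val Γ A),
      (EffCalc.termModel Op).val V = (EffCalc.termModel Op).val W → EffCalc.ValEq V W) ∧
    (∀ (C : EffCalc.CTy Op) (M N : EffCalc.Comp Γ C),
      (EffCalc.termModel Op).comp M = (EffCalc.termModel Op).comp N → EffCalc.CompEq M N) ∧
    (∀ (S : EffCalc.Sig Op) (C : EffCalc.CTy Op) (H H' : EffCalc.Handler Γ S C),
      (EffCalc.termModel Op).handler H = (EffCalc.termModel Op).handler H' →
        EffCalc.HandlerEq H H') :=
  ⟨fun _ _ _ => EffCalc.TermModel.valEq_of_val_eq,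
    fun _ _ _ => EffCalc.TermModel.compEq_of_comp_eq,
    fun _ _ _ _ => EffCalc.TermModel.handlerEq_of_handler_eq⟩

theorem mainTheorem1 {Op : Type*} (Γ : EffCalc.Ctx Op) :
    (∀ (A : EffCalc.Ty Op) (V W : EffCalc.Val Γ A),
      (∀ 𝓜 : EffCalc.Model Op, 𝓜.val V = 𝓜.val W) → EffCalc.ValEq V W) ∧
    (∀ (C : EffCalc.CTy Op) (M N : EffCalc.Comp Γ C),
      (∀ 𝓜 : EffCalc.Model Op, 𝓜.comp M = 𝓜.comp N) → EffCalc.CompEq M N) ∧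
    (∀ (S : EffCalc.Sig Op) (C : EffCalc.CTy Op) (H H' : EffCalc.Handler Γ S C),
      (∀ 𝓜 : EffCalc.Model Op, 𝓜.handler H = 𝓜.handler H') → EffCalc.HandlerEq H H') :=
  have ⟨hVal, hComp, hHandler⟩ := mainTheorem1_general Γ
  ⟨fun _ _ _ h => hVal _ _ _ (h _), fun _ _ _ h => hComp _ _ _ (h _),
    fun _ _ _ _ h => hHandler _ _ _ _ (h _)⟩
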